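/- **Setting.** Let $\alpha>-1/2$. Let $G_n^{(\alpha)}$ be the Gegenbauer polynomials with $G_0=1$, $G_1(x)=x$ and $(n+2\alpha)G_{n+1}=2(n+\alpha)xG_n-nG_{n-1}$ for $n\ge1$. Let $x_{n,0}>\dots>x_{n,n}$ be the zeros of $G_{n+1}^{(\alpha)}-G_n^{(\alpha)}$, and for $b>0$ let $x_{b,n,i}=\frac b2(x_{n,i}+1)\in(0,b]$ be the SFGGR nodes (so $x_{b,n,0}=b$). Let $L_{n,k}$ be the Lagrange basis polynomials at $x_{n,0},\dots,x_{n,n}$, and set $$Q^{(1)}_{b,i,k}=\frac b2\int_{-1}^{x_{n,i}}L_{n,k}(t)\,dt,\qquad Q^{(2)}_{b,i,k}=(x_{b,n,i}-x_{b,n,k})\,Q^{(1)}_{b,i,k}.$$ Consider the linear Lane-Emden problem $$y''(x)+\frac{\alpha_2}{x}y'(x)+p(x)y(x)=g(x)\ \ (0<x\le b),\qquad y'(0)=\alpha_1,\qquad \beta y(b)+\gamma y'(b)=\delta,$$ with $\beta=0$ and $\gamma\neq0$. For $\Phi\in\mathbb R^{n+1}$ and $y_0\in\mathbb R$ the shifted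 Gegenbauer integral pseudospectral method recovers nodal values by $$y''_{\mathrm{app},n}(x_{b,n,i})=\Phi_i,\quad y'_{\mathrm{app},n}(x_{b,n,i})=\alpha_1+\sum_kQ^{(1)}_{b,i,k}\Phi_k,\quad y_{\mathrm{app},n}(x_{b,n,i})=y_0+\alpha_1x_{b,n,i}+\sum_kQ^{(2)}_{b,i,k}\Phi_k,$$ and its residual at the nodes is $$\mathcal R(x_{b,n,i})=y''_{\mathrm{app},n}(x_{b,n,i})+\frac{\alpha_2}{x_{b,n,i}}y'_{\mathrm{app},n}(x_{b,n,i})+p(x_{b,n,i})\,y_{\mathrm{app},n}(x_{b,n,i})-g(x_{b,n,i}).$$ **Corollary.** For all real $\alpha>-1/2$, $\alpha_2$ and $A$ there are constants $B^{(\alpha)},C^{(\alpha)}>0$, independent of $n$, $b$ and all other data, such that the following holds. Let $y$ be a solution of the problem above that is infinitely differentiable on $(0,b]$ with $\sup_{(0,b]}|y^{(n+3)}|\le A$ for all $n\ge0$, and let $\|p\|_{\infty,(0,b]}=M<\infty$. Then for every $\varepsilon>0$ there is a positive integer $N$ such that for all $n\ge N$ and all $i=0,\dots,n$ $$|\mathcal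 R(x_{b,n,i})|\le\begin{cases}\varepsilon M+B^{(\alpha)}\,b^{n+1}\left(\frac e4\right)^n n^{-n-\frac32+\alpha},&\alpha\ge0,\\[2pt] \varepsilon M+C^{(\alpha)}\,2^{-2n-1}\,b^{n+1}e^n\,n^{-n-\frac32},&-\frac12<\alpha<0,\end{cases}$$ where $\Phi_k=y''(x_{b,n,k})$ $(0\le k\le n)$ and $y_0=y(0)$. The same bounds hold if $(\Phi,y_0)$ is instead any solution of the collocation system of the method, that is, of $\mathcal R(x_{b,n,i})=0$ $(0\le i\le n)$ and $\sum_kQ^{(1)}_{b,0,k}\Phi_k=\delta/\gamma-\alpha_1$. -/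

import Mathlib

open Polynomial

noncomputable section

/-- The Gegenbauer polynomials, standardized by `G_n(1) = 1`:
`(n + 2α) G_{n+1} = 2 (n + α) x G_n - n G_{n-1}` with `G_0 = 1`, `G_1 = x`. -/
def gegenbauer (α : ℝ) : ℕ → ℝ[X]
  | 0 => 1
  | 1 => X
  | (n + 2) =>
      C (((n + 1 : ℕ) + 2 * α)⁻¹) *
        (C (2 * ((n + 1 : ℕ) + α)) * X * gegenbauer α (n + 1)
          - C ((n + 1 : ℕ) : ℝ) * gegenbauer α n)

/-- The polynomial `q_n = G_{n+1} - G_n`, whose zeros are the flipped Gegenbauer-Gauss-Radau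
(FGGR) nodes. -/
def radauPoly (α : ℝ) (n : ℕ) : ℝ[X] := gegenbauer α (n + 1) - gegenbauer α n

/-- The FGGR nodes `x_{n,0} > x_{n,1} > ⋯ > x_{n,n}` in `[-1, 1]`: the zeros of `q_n`, sorted in
descending order. -/
def fggrNode (α : ℝ) (n : ℕ) (k : Fin (n + 1)) : ℝ :=
  ((radauPoly α n).roots.sort (· ≥ ·)).getD k 0

/-- The shifted nodes (SFGGR nodes) `x_{b,n,k} = (b/2) (x_{n,k} + 1)` in `[0, b]`. -/
def sfggrNode (α b : ℝ) (n : ℕ) (k : Fin (n + 1)) : ℝ :=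
  b / 2 * (fggrNode α n k + 1)

/-- The first-order Gegenbauer integration matrix at the FGGR nodes. It maps the vector of values
of `f` at the nodes to the integrals over `[-1, x_{n,i}]` of the polynomial of degree at most `n`
that interpolates `f` at the nodes. -/
def intMatrix (α : ℝ) (n : ℕ) : Matrix (Fin (n + 1)) (Fin (n + 1)) ℝ :=
  Matrix.of fun i k =>
    ∫ t in (-1 : ℝ)..fggrNode α n i,
      (Lagrange.basis Finset.univ (fggrNode α n) k).eval t

/-- The first-order shifted integration matrix `Q_b^{(1)} = (b/2) Q^{(1)}`. -/
def shiftedIntMatrix₁ (α b : ℝ) (n : ℕ) : Matrix (Fin (n + 1)) (Fin (n + 1)) ℝ :=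
  (b / 2) • intMatrix α n

/-- The second-order shifted integration matrix, with entries
`(x_{b,n,i} - x_{b,n,k}) * Q_b^{(1)} i k`. -/
def shiftedIntMatrix₂ (α b : ℝ) (n : ℕ) : Matrix (Fin (n + 1)) (Fin (n + 1)) ℝ :=
  Matrix.of fun i k =>
    (sfggrNode α b n i - sfggrNode α b n k) * shiftedIntMatrix₁ α b n i k

/-- `y` solves the linear Lane-Emden problem
`y'' + (α₂/x) y' + p y = g` on `(0, b]`, `y'(0) = α₁`, `β y(b) + γ y'(b) = δ`.
Derivatives on `(0, b]` are one-sided at `b`, and `y'(0)` is the right derivative at `0`. -/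
structure IsLaneEmdenSolution (b α₁ α₂ β γ δ : ℝ) (p g y : ℝ → ℝ) : Prop where
  ode : ∀ x ∈ Set.Ioc 0 b,
    iteratedDerivWithin 2 y (Set.Ioc 0 b) x + α₂ / x * derivWithin y (Set.Ioc 0 b) x
      + p x * y x = g x
  deriv_zero : HasDerivWithinAt y α₁ (Set.Icc 0 b) 0
  boundary : β * y b + γ * derivWithin y (Set.Ioc 0 b) b = δ

section Method

variable (α b α₁ α₂ : ℝ) (n : ℕ) (p g : ℝ → ℝ) (Φ : Fin (n + 1) → ℝ) (y₀ : ℝ)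

/-- Nodal values of the first derivative of the approximate solution that the method recovers
from the nodal values `Φ` of the second derivative. -/
def yAppDeriv (i : Fin (n + 1)) : ℝ :=
  α₁ + (shiftedIntMatrix₁ α b n).mulVec Φ i

/-- Nodal values of the approximate solution that the method recovers from the nodal values `Φ`
of the second derivative and the value `y₀` at `0`. -/
def yApp (i : Fin (n + 1)) : ℝ :=
  y₀ + α₁ * sfggrNode α b n i + (shiftedIntMatrix₂ α b n).mulVec Φ i

/-- The residual `L y_app - g` at the node `x_{b,n,i}`, where `L = d²/dx² + (α₂/x) d/dx + p`. -/
def nodalResidual (i : Fin (n + 1)) : ℝ :=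
  Φ i + α₂ / sfggrNode α b n i * yAppDeriv α b α₁ n Φ i
    + p (sfggrNode α b n i) * yApp α b α₁ n Φ y₀ i - g (sfggrNode α b n i)

/-- Coefficient matrix of the collocation system of the method when `β = 0`, in the unknowns
`(Φ, y₀)`. The last row is the boundary condition at `b`, which is the node of index `0`. -/
def collocationMatrix : Matrix (Fin (n + 1) ⊕ Unit) (Fin (n + 1) ⊕ Unit) ℝ :=
  Matrix.fromBlocks
    (1 + α₂ • (Matrix.diagonal (fun i => (sfggrNode α b n i)⁻¹) * shiftedIntMatrix₁ α b n)
      + Matrix.diagonal (fun i => p (sfggrNode α b n i)) * shiftedIntMatrix₂ α b n)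
    (Matrix.of fun i _ => p (sfggrNode α b n i))
    (Matrix.of fun _ k => shiftedIntMatrix₁ α b n 0 k)
    0

/-- Right-hand side of the collocation system of the method when `β = 0`. -/
def collocationRhs (γ δ : ℝ) : Fin (n + 1) ⊕ Unit → ℝ :=
  Sum.elim
    (fun i => g (sfggrNode α b n i) - α₁ * (p (sfggrNode α b n i) * sfggrNode α b n i)
      - α₁ * α₂ * (sfggrNode α b n i)⁻¹)
    (fun _ => δ / γ - α₁)

/-- The nodal residual of `(Φ, y₀)` is its defect in the collocation equations of the method. -/
theorem nodalResidual_eq_defect (γ δ : ℝ) (i : Fin (n + 1)) :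
    nodalResidual α b α₁ α₂ n p g Φ y₀ i =
      (collocationMatrix α b α₂ n p).mulVec (Sum.elim Φ fun _ => y₀) (Sum.inl i)
        - collocationRhs α b α₁ α₂ n p g γ δ (Sum.inl i) := by
  simp only [nodalResidual, yAppDeriv, yApp, collocationMatrix, collocationRhs,
    Matrix.fromBlocks_mulVec, Sum.elim_inl, Sum.elim_comp_inl, Sum.elim_comp_inr,
    Matrix.add_mulVec, Matrix.one_mulVec, Matrix.smul_mulVec, ← Matrix.mulVec_mulVec,
    Pi.add_apply, Pi.smul_apply, Matrix.mulVec_diagonal, smul_eq_mul]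
  simp only [Matrix.mulVec, dotProduct, Matrix.of_apply, Finset.univ_unique,
    Finset.sum_singleton]
  ring

end Method

end

/-! A solution of the collocation system has zero nodal residual, so only the exact data `Φ = y''`,
`y₀ = y(0)` need work. Subtracting the differential equation at a node `x` leaves `p(x)` times the
error in `y` plus `α₂ / x` times the error in `y'`. Both errors are quadrature errors: row `i` of
the first matrix integrates the interpolant exactly, and the second matrix applied to `y''` is the
first applied to `(x - t) y''(t)`, whose antiderivative is `(x - t) y' + y`. The interpolation error
is at most a derivative bound over `(n+1)!` times the node polynomial; integrated from `0` to `x` it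
gains a factor `x`, which cancels the singular `1 / x` (`abs_shiftedIntMatrix₁_mulVec_sub_le`).

For the error in `y` the crude bound `2^(n+1)` on the node polynomial suffices: the result tends to
`0` and becomes `ε M`. The error in `y'` needs the sharp size of the node polynomial `(G_{n+1} -
G_n) / (2^n κ_n)` on `[-1, 1]`, where `κ_n` is `gegenbauerLead`. A Sonin energy puts the extremes at
`±1` for `α ≥ 0`, where `|G_n| = 1`, and `κ_n` decays no faster than a multiple of `n^(-α)`. For `α
< 0` the energy peaks at `0`, and `G` is bounded by a multiple of `κ_n`. Stirling's inequality then
gives the stated form.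

All this needs `n + 1` distinct nodes in `(-1, 1]`: the zeros of `G_{n+1} - G_n` are real, simple
and located there. -/

/-! ### Recurrence, degrees and leading coefficients. -/

theorem natCast_succ_add_two_mul_pos {α : ℝ} (hα : -1 / 2 < α) (n : ℕ) :
    0 < (n : ℝ) + 1 + 2 * α := by
  have : (0 : ℝ) ≤ n := n.cast_nonneg
  linarith

theorem natCast_succ_add_pos {α : ℝ} (hα : -1 / 2 < α) (n : ℕ) : 0 < (n : ℝ) + 1 + α := by
  have : (0 : ℝ) ≤ n := n.cast_nonneg
  linarith

theorem gegenbauer_recurrence {α : ℝ} (hα : -1 / 2 < α) (n : ℕ) :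
    C ((n : ℝ) + 1 + 2 * α) * gegenbauer α (n + 2) =
      C (2 * ((n : ℝ) + 1 + α)) * X * gegenbauer α (n + 1)
        - C ((n : ℝ) + 1) * gegenbauer α n := by
  have h := (natCast_succ_add_two_mul_pos hα n).ne'
  rw [gegenbauer, ← mul_assoc, ← C_mul]
  push_cast
  rw [mul_inv_cancel₀ h, C_1, one_mul]

theorem eval_gegenbauer_recurrence {α : ℝ} (hα : -1 / 2 < α) (n : ℕ) (x : ℝ) :
    ((n : ℝ) + 1 + 2 * α) * (gegenbauer α (n + 2)).eval x =
      2 * ((n : ℝ) + 1 + α) * x * (gegenbauer α (n + 1)).eval x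
        - ((n : ℝ) + 1) * (gegenbauer α n).eval x := by
  simpa using congrArg (eval x) (gegenbauer_recurrence hα n)

/-- The leading coefficient of `G_{n+1}` divided by `2 ^ n`. -/
noncomputable def gegenbauerLead (α : ℝ) (n : ℕ) : ℝ :=
  ∏ j ∈ Finset.range n, ((j : ℝ) + 1 + α) / ((j : ℝ) + 1 + 2 * α)

theorem gegenbauerLead_pos {α : ℝ} (hα : -1 / 2 < α) (n : ℕ) : 0 < gegenbauerLead α n :=
  Finset.prod_pos fun j _ =>
    div_pos (natCast_succ_add_pos hα j) (natCast_succ_add_two_mul_pos hα j)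

theorem gegenbauerLead_succ (α : ℝ) (n : ℕ) :
    gegenbauerLead α (n + 1) =
      gegenbauerLead α n * (((n : ℝ) + 1 + α) / ((n : ℝ) + 1 + 2 * α)) :=
  Finset.prod_range_succ _ _

theorem gegenbauer_natDegree_le_and_coeff {α : ℝ} (hα : -1 / 2 < α) (n : ℕ) :
    (gegenbauer α n).natDegree ≤ n ∧ (gegenbauer α (n + 1)).natDegree ≤ n + 1 ∧
      (gegenbauer α (n + 1)).coeff (n + 1) = 2 ^ n * gegenbauerLead α n := by
  induction n with
  | zero => simp [gegenbauer, gegenbauerLead]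
  | succ n ih =>
    obtain ⟨h0, h1, h2⟩ := ih
    have hne := (natCast_succ_add_two_mul_pos hα n).ne'
    refine ⟨h1, ?_, ?_⟩
    · rw [gegenbauer]
      refine (natDegree_C_mul_le _ _).trans ((natDegree_sub_le _ _).trans (max_le ?_ ?_))
      · refine natDegree_mul_le.trans ?_
        have := natDegree_C_mul_le (2 * (((n + 1 : ℕ) : ℝ) + α)) X
        rw [natDegree_X] at this
        lia
      · exact (natDegree_C_mul_le _ _).trans (by lia)
    · have h := congrArg (fun p => coeff p (n + 2)) (gegenbauer_recurrence hα n)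
      have h3 : (gegenbauer α n).coeff (n + 2) = 0 := coeff_eq_zero_of_natDegree_lt (by lia)
      simp only [coeff_C_mul, coeff_sub, mul_assoc, coeff_X_mul, h2, h3] at h
      refine mul_left_cancel₀ hne ?_
      rw [gegenbauerLead_succ]
      have h4 := mul_div_cancel₀ ((n : ℝ) + 1 + α) hne
      linear_combination h - 2 ^ (n + 1) * gegenbauerLead α n * h4

theorem radauPoly_coeff {α : ℝ} (hα : -1 / 2 < α) (n : ℕ) :
    (radauPoly α n).coeff (n + 1) = 2 ^ n * gegenbauerLead α n := by
  obtain ⟨h0, -, h2⟩ := gegenbauer_natDegree_le_and_coeff hα n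
  rw [radauPoly, coeff_sub, h2, coeff_eq_zero_of_natDegree_lt (by lia), sub_zero]

theorem radauPoly_natDegree {α : ℝ} (hα : -1 / 2 < α) (n : ℕ) :
    (radauPoly α n).natDegree = n + 1 := by
  obtain ⟨h0, h1, -⟩ := gegenbauer_natDegree_le_and_coeff hα n
  refine natDegree_eq_of_le_of_coeff_ne_zero
    ((natDegree_sub_le _ _).trans (max_le h1 (by lia))) ?_
  rw [radauPoly_coeff hα]
  exact (mul_pos (by positivity) (gegenbauerLead_pos hα n)).ne'

theorem radauPoly_leadingCoeff {α : ℝ} (hα : -1 / 2 < α) (n : ℕ) :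
    (radauPoly α n).leadingCoeff = 2 ^ n * gegenbauerLead α n := by
  rw [leadingCoeff, radauPoly_natDegree hα, radauPoly_coeff hα]

theorem radauPoly_ne_zero {α : ℝ} (hα : -1 / 2 < α) (n : ℕ) : radauPoly α n ≠ 0 := by
  intro h
  have := radauPoly_natDegree hα n
  simp [h] at this

/-! ### Zeros of the Radau polynomial: real, simple, in `(-1, 1]`. -/

/-- The recurrence rearranges to `(n+1+2α)(G_{n+2} - G_{n+1}) = (n+1)(G_{n+1} - G_n) + 2(n+1+α)(x-1)
G_{n+1}`, so positivity of the increments propagates. -/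
theorem gegenbauer_lt_succ_of_one_lt {α : ℝ} (hα : -1 / 2 < α) {x : ℝ} (hx : 1 < x) (n : ℕ) :
    0 < (gegenbauer α n).eval x ∧
      (gegenbauer α n).eval x < (gegenbauer α (n + 1)).eval x := by
  induction n with
  | zero => simpa [gegenbauer] using hx
  | succ n ih =>
    have h1 := natCast_succ_add_two_mul_pos hα n
    have h2 := natCast_succ_add_pos hα n
    have h := eval_gegenbauer_recurrence hα n x
    have hG : 0 < (gegenbauer α (n + 1)).eval x := ih.1.trans ih.2
    refine ⟨hG, ?_⟩
    have h3 : 0 < ((n : ℝ) + 1) *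
        ((gegenbauer α (n + 1)).eval x - (gegenbauer α n).eval x) :=
      mul_pos (by positivity) (sub_pos.2 ih.2)
    have h4 : 0 < 2 * ((n : ℝ) + 1 + α) * (x - 1) * (gegenbauer α (n + 1)).eval x :=
      mul_pos (mul_pos (by linarith) (by linarith)) hG
    refine lt_of_mul_lt_mul_left ?_ h1.le
    rw [h]
    linarith

/-- Mirror image of the previous argument for `(-1)^n G_n`. The endpoint `-1` is included, where the
increments vanish; the alternating signs still exclude a zero of `G_{n+1} - G_n` there. -/
theorem gegenbauer_sign_of_le_neg_one {α : ℝ} (hα : -1 / 2 < α) {x : ℝ} (hx : x ≤ -1) (n : ℕ) :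
    0 < (-1) ^ n * (gegenbauer α n).eval x ∧
      (-1) ^ n * (gegenbauer α n).eval x ≤ (-1) ^ (n + 1) * (gegenbauer α (n + 1)).eval x := by
  induction n with
  | zero => simp [gegenbauer]; linarith
  | succ n ih =>
    have h1 := natCast_succ_add_two_mul_pos hα n
    have h2 := natCast_succ_add_pos hα n
    have h := eval_gegenbauer_recurrence hα n x
    have hG := ih.1.trans_le ih.2
    refine ⟨hG, ?_⟩
    have h3 : 0 ≤ ((n : ℝ) + 1) * ((-1) ^ (n + 1) * (gegenbauer α (n + 1)).eval x
        - (-1) ^ n * (gegenbauer α n).eval x) :=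
      mul_nonneg (by positivity) (sub_nonneg.2 ih.2)
    have h4 : 0 ≤ 2 * ((n : ℝ) + 1 + α) * (-x - 1) *
        ((-1) ^ (n + 1) * (gegenbauer α (n + 1)).eval x) :=
      mul_nonneg (mul_nonneg (by linarith) (by linarith)) hG.le
    refine le_of_mul_le_mul_left ?_ h1
    have h5 : ((n : ℝ) + 1 + 2 * α) *
        ((-1) ^ (n + 1 + 1) * (gegenbauer α (n + 1 + 1)).eval x) =
        (-1) ^ n * (2 * ((n : ℝ) + 1 + α) * x * (gegenbauer α (n + 1)).eval x
        - ((n : ℝ) + 1) * (gegenbauer α n).eval x) := by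
      rw [← h]; ring
    rw [h5]
    simp only [pow_succ] at h3 h4 ⊢
    linarith

theorem eval_gegenbauer_one {α : ℝ} (hα : -1 / 2 < α) (n : ℕ) :
    (gegenbauer α n).eval 1 = 1 ∧ (gegenbauer α (n + 1)).eval 1 = 1 := by
  induction n with
  | zero => simp [gegenbauer]
  | succ n ih =>
    refine ⟨ih.2, mul_left_cancel₀ (natCast_succ_add_two_mul_pos hα n).ne' ?_⟩
    rw [eval_gegenbauer_recurrence hα, ih.1, ih.2]
    ring

theorem eval_gegenbauer_neg_one {α : ℝ} (hα : -1 / 2 < α) (n : ℕ) :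
    (gegenbauer α n).eval (-1) = (-1) ^ n ∧
      (gegenbauer α (n + 1)).eval (-1) = (-1) ^ (n + 1) := by
  induction n with
  | zero => simp [gegenbauer]
  | succ n ih =>
    refine ⟨ih.2, mul_left_cancel₀ (natCast_succ_add_two_mul_pos hα n).ne' ?_⟩
    rw [eval_gegenbauer_recurrence hα, ih.1, ih.2]
    ring

theorem mem_Ioc_of_radauPoly_root {α : ℝ} (hα : -1 / 2 < α) (n : ℕ) {x : ℝ}
    (hx : (radauPoly α n).eval x = 0) : x ∈ Set.Ioc (-1 : ℝ) 1 := by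
  rw [radauPoly, eval_sub, sub_eq_zero] at hx
  constructor
  · by_contra! h
    obtain ⟨h1, h2⟩ := gegenbauer_sign_of_le_neg_one hα h n
    rw [hx, pow_succ] at h2
    linarith
  · by_contra! h
    exact (gegenbauer_lt_succ_of_one_lt hα h n).2.ne' hx

/-- Multiplying the recurrence by the conjugate of `G_{n+1}(z)` gives a positive multiple of `Im z
|G_{n+1}|²` plus `n + 1` times the previous quantity. Hence `G_{n+1}(z) = G_n(z)` is impossible off
the real line, as the product would then be the real number `|G_n(z)|²`. -/
theorem gegenbauer_im_pos {α : ℝ} (hα : -1 / 2 < α) {z : ℂ} (hz : 0 < z.im) (n : ℕ) :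
    0 < (aeval z (gegenbauer α (n + 1)) * (starRingEnd ℂ) (aeval z (gegenbauer α n))).im := by
  induction n with
  | zero => simpa [gegenbauer] using hz
  | succ n ih =>
    have h1 := natCast_succ_add_two_mul_pos hα n
    have h2 := natCast_succ_add_pos hα n
    have h : (((n : ℝ) + 1 + 2 * α : ℝ) : ℂ) * aeval z (gegenbauer α (n + 2)) =
        ((2 * ((n : ℝ) + 1 + α) : ℝ) : ℂ) * z * aeval z (gegenbauer α (n + 1)) -
          (((n : ℝ) + 1 : ℝ) : ℂ) * aeval z (gegenbauer α n) := by
      simpa only [map_mul, map_sub, aeval_C, aeval_X, Complex.coe_algebraMap,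
        Complex.ofReal_mul] using
        congrArg (aeval z) (gegenbauer_recurrence hα n)
    change 0 < (aeval z (gegenbauer α (n + 2)) * _).im
    generalize aeval z (gegenbauer α n) = u at *
    generalize aeval z (gegenbauer α (n + 1)) = v at *
    generalize aeval z (gegenbauer α (n + 2)) = w at *
    have hre := congrArg Complex.re h
    have him := congrArg Complex.im h
    simp only [Complex.mul_re, Complex.mul_im, Complex.sub_re, Complex.sub_im, Complex.ofReal_re,
      Complex.ofReal_im, zero_mul, sub_zero, add_zero] at hre him
    simp only [Complex.mul_im, Complex.conj_re, Complex.conj_im] at ih ⊢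
    have hv : 0 < v.re ^ 2 + v.im ^ 2 := by
      by_contra! h0
      have hr : v.re = 0 := by nlinarith [sq_nonneg v.re, sq_nonneg v.im]
      have hi : v.im = 0 := by nlinarith [sq_nonneg v.re, sq_nonneg v.im]
      simp [hr, hi] at ih
    have h3 := mul_pos (mul_pos h2 hz) hv
    have h4 := mul_pos (show (0 : ℝ) < (n : ℝ) + 1 by positivity) ih
    refine pos_of_mul_pos_right (a := (n : ℝ) + 1 + 2 * α) ?_ h1.le
    linear_combination v.im * hre - v.re * him + 2 * h3 + h4

theorem radauPoly_complex_root_im {α : ℝ} (hα : -1 / 2 < α) (n : ℕ) {z : ℂ}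
    (hz : aeval z (radauPoly α n) = 0) : z.im = 0 := by
  have key : ∀ w : ℂ, aeval w (radauPoly α n) = 0 → ¬ 0 < w.im := by
    intro w hw h
    have := gegenbauer_im_pos hα h n
    rw [radauPoly, map_sub, sub_eq_zero] at hw
    rw [hw, Complex.mul_conj] at this
    simp at this
  have h1 := key z hz
  have h2 := key ((starRingEnd ℂ) z) (by
    have : aeval ((starRingEnd ℂ) z) (radauPoly α n) =
        (starRingEnd ℂ) (aeval z (radauPoly α n)) :=
      aeval_conj _ _
    rw [this, hz, map_zero])
  simp only [Complex.conj_im] at h2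
  linarith

theorem radauPoly_splits {α : ℝ} (hα : -1 / 2 < α) (n : ℕ) : (radauPoly α n).Splits := by
  refine Splits.of_splits_map (algebraMap ℝ ℂ) (IsAlgClosed.splits _) fun z hz => ?_
  have hz' : aeval z (radauPoly α n) = 0 := by
    rw [mem_roots', IsRoot, eval_map_algebraMap] at hz
    exact hz.2
  exact ⟨z.re, Complex.ext rfl (radauPoly_complex_root_im hα n hz').symm⟩

/-- The confluent Christoffel–Darboux argument: the recurrence adds `2(n+1+α) G_{n+1}²` at each
step. At a double zero of `G_{n+1} - G_n` the Wronskian would vanish, so the zeros are simple. -/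
theorem gegenbauer_wronskian_pos {α : ℝ} (hα : -1 / 2 < α) (x : ℝ) (n : ℕ) :
    0 < (derivative (gegenbauer α (n + 1))).eval x * (gegenbauer α n).eval x
      - (derivative (gegenbauer α n)).eval x * (gegenbauer α (n + 1)).eval x := by
  induction n with
  | zero => simp [gegenbauer]
  | succ n ih =>
    have h1 := natCast_succ_add_two_mul_pos hα n
    have h2 := natCast_succ_add_pos hα n
    have h := eval_gegenbauer_recurrence hα n x
    have h' := congrArg (fun p => (derivative p).eval x) (gegenbauer_recurrence hα n)
    simp only [derivative_mul, derivative_sub, derivative_C, derivative_X, eval_add, eval_sub,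
      eval_mul, eval_C, eval_X, zero_mul, zero_add, mul_one] at h'
    have h3 := mul_nonneg h2.le (sq_nonneg ((gegenbauer α (n + 1)).eval x))
    have h4 := mul_pos (show (0 : ℝ) < (n : ℝ) + 1 by positivity) ih
    refine pos_of_mul_pos_right (a := (n : ℝ) + 1 + 2 * α) ?_ h1.le
    change (_ : ℝ) < _ * (eval x (derivative (gegenbauer α (n + 2))) * _
      - _ * eval x (gegenbauer α (n + 2)))
    linear_combination (derivative (gegenbauer α (n + 1))).eval x * h
      - (gegenbauer α (n + 1)).eval x * h' + 2 * h3 + h4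

theorem radauPoly_roots_nodup {α : ℝ} (hα : -1 / 2 < α) (n : ℕ) :
    (radauPoly α n).roots.Nodup := by
  classical
  refine Multiset.nodup_iff_count_le_one.2 fun x => ?_
  rw [count_roots]
  by_contra! h
  obtain ⟨h0, h1⟩ := (one_lt_rootMultiplicity_iff_isRoot (radauPoly_ne_zero hα n)).1 h
  rw [IsRoot, radauPoly, eval_sub, sub_eq_zero] at h0
  rw [IsRoot, radauPoly, derivative_sub, eval_sub, sub_eq_zero] at h1
  have := gegenbauer_wronskian_pos hα x n
  rw [h0, h1] at this
  linarith

theorem card_roots_radauPoly {α : ℝ} (hα : -1 / 2 < α) (n : ℕ) :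
    Multiset.card (radauPoly α n).roots = n + 1 := by
  rw [← (radauPoly_splits hα n).natDegree_eq_card_roots, radauPoly_natDegree hα]

theorem fggrNode_eq_get {α : ℝ} (hα : -1 / 2 < α) (n : ℕ) (k : Fin (n + 1)) :
    ∃ h : (k : ℕ) < ((radauPoly α n).roots.sort (· ≥ ·)).length,
      fggrNode α n k = ((radauPoly α n).roots.sort (· ≥ ·))[(k : ℕ)] := by
  have h : (k : ℕ) < ((radauPoly α n).roots.sort (· ≥ ·)).length := by
    rw [Multiset.length_sort, card_roots_radauPoly hα]
    exact k.2
  exact ⟨h, List.getD_eq_getElem _ _ h⟩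

theorem fggrNode_injective {α : ℝ} (hα : -1 / 2 < α) (n : ℕ) :
    Function.Injective (fggrNode α n) := by
  intro i j hij
  obtain ⟨hi, ei⟩ := fggrNode_eq_get hα n i
  obtain ⟨hj, ej⟩ := fggrNode_eq_get hα n j
  have hn : ((radauPoly α n).roots.sort (· ≥ ·)).Nodup := by
    rw [← Multiset.coe_nodup, Multiset.sort_eq]
    exact radauPoly_roots_nodup hα n
  rw [ei, ej] at hij
  exact Fin.ext ((hn.getElem_inj_iff).1 hij)

theorem fggrNode_mem_roots {α : ℝ} (hα : -1 / 2 < α) (n : ℕ) (k : Fin (n + 1)) :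
    fggrNode α n k ∈ (radauPoly α n).roots := by
  obtain ⟨h, e⟩ := fggrNode_eq_get hα n k
  rw [e, ← Multiset.mem_sort (· ≥ ·)]
  exact List.getElem_mem h

theorem fggrNode_mem_Ioc {α : ℝ} (hα : -1 / 2 < α) (n : ℕ) (k : Fin (n + 1)) :
    fggrNode α n k ∈ Set.Ioc (-1 : ℝ) 1 :=
  mem_Ioc_of_radauPoly_root hα n (isRoot_of_mem_roots (fggrNode_mem_roots hα n k))

theorem radauPoly_eq_prod {α : ℝ} (hα : -1 / 2 < α) (n : ℕ) :
    radauPoly α n =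
      C (2 ^ n * gegenbauerLead α n) * ∏ k, (X - C (fggrNode α n k)) := by
  have hs : Finset.univ.val.map (fggrNode α n) = (radauPoly α n).roots := by
    refine Multiset.eq_of_le_of_card_le ((Multiset.le_iff_subset ?_).2 ?_) ?_
    · exact Finset.univ.nodup.map (fggrNode_injective hα n)
    · intro x hx
      obtain ⟨k, -, rfl⟩ := Multiset.mem_map.1 hx
      exact fggrNode_mem_roots hα n k
    · simp [card_roots_radauPoly hα]
  conv_lhs => rw [(radauPoly_splits hα n).eq_prod_roots, radauPoly_leadingCoeff hα, ← hs]
  rw [Multiset.map_map]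
  rfl

/-! ### Differential equation and energy of the Gegenbauer polynomials. -/

/-- The two relations feed each other in the induction. Together they give the differential
equation: differentiate the second and eliminate `G_n'` by the first. -/
theorem one_sub_sq_mul_derivative_gegenbauer {α : ℝ} (hα : -1 / 2 < α) (x : ℝ) (n : ℕ) :
    (1 - x ^ 2) * (derivative (gegenbauer α n)).eval x =
        ((n : ℝ) + 2 * α) * (x * (gegenbauer α n).eval x - (gegenbauer α (n + 1)).eval x) ∧
      (1 - x ^ 2) * (derivative (gegenbauer α (n + 1))).eval x =
        ((n : ℝ) + 1) * ((gegenbauer α n).eval x - x * (gegenbauer α (n + 1)).eval x) := by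
  induction n with
  | zero => simp [gegenbauer]; ring
  | succ n ih =>
    obtain ⟨ih0, ih1⟩ := ih
    have hne := (natCast_succ_add_two_mul_pos hα n).ne'
    have h := eval_gegenbauer_recurrence hα n x
    have h' := congrArg (fun p => (derivative p).eval x) (gegenbauer_recurrence hα n)
    simp only [derivative_mul, derivative_sub, derivative_C, derivative_X, eval_add, eval_sub,
      eval_mul, eval_C, eval_X, zero_mul, zero_add, mul_one] at h'
    change _ = (((n + 1 : ℕ) : ℝ) + 2 * α) *
      (x * (gegenbauer α (n + 1)).eval x - (gegenbauer α (n + 2)).eval x) ∧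
      (1 - x ^ 2) * (derivative (gegenbauer α (n + 2))).eval x =
        (((n + 1 : ℕ) : ℝ) + 1) *
          ((gegenbauer α (n + 1)).eval x - x * (gegenbauer α (n + 2)).eval x)
    push_cast
    refine ⟨by linear_combination ih1 + h, mul_left_cancel₀ hne ?_⟩
    linear_combination (1 - x ^ 2) * h' + 2 * ((n : ℝ) + 1 + α) * x * ih1
      - ((n : ℝ) + 1) * ih0 + ((n : ℝ) + 2) * x * h

theorem gegenbauer_ode {α : ℝ} (hα : -1 / 2 < α) {x : ℝ} (hx : 1 - x ^ 2 ≠ 0) (n : ℕ) :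
    (1 - x ^ 2) * (derivative (derivative (gegenbauer α (n + 1)))).eval x =
      (1 + 2 * α) * x * (derivative (gegenbauer α (n + 1))).eval x
        - ((n : ℝ) + 1) * ((n : ℝ) + 1 + 2 * α) * (gegenbauer α (n + 1)).eval x := by
  have hpoly : (1 - X ^ 2) * derivative (gegenbauer α (n + 1)) =
      C ((n : ℝ) + 1) * (gegenbauer α n - X * gegenbauer α (n + 1)) :=
    Polynomial.funext fun t => by
      simpa using (one_sub_sq_mul_derivative_gegenbauer hα t n).2
  have h := congrArg (fun p => (derivative p).eval x) hpoly
  simp only [derivative_mul, derivative_sub, derivative_C, derivative_X, derivative_X_pow,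
    derivative_one, eval_add, eval_sub, eval_mul, eval_C, eval_X, eval_pow, eval_one,
    zero_mul, zero_add, one_mul, Nat.add_one_sub_one, pow_one, zero_sub, Nat.cast_ofNat,
    eval_neg] at h
  obtain ⟨h0, h1⟩ := one_sub_sq_mul_derivative_gegenbauer hα x n
  refine mul_left_cancel₀ hx ?_
  linear_combination (1 - x ^ 2) * h + ((n : ℝ) + 1) * h0 - ((n : ℝ) + 2 * α) * x * h1

/-- The energy of `G_{n+1}`, whose derivative has the sign of `α x` on `[-1, 1]`. -/
noncomputable def gegenbauerEnergy (α : ℝ) (n : ℕ) (x : ℝ) : ℝ :=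
  ((n : ℝ) + 1) * ((n : ℝ) + 1 + 2 * α) * (gegenbauer α (n + 1)).eval x ^ 2
    + (1 - x ^ 2) * (derivative (gegenbauer α (n + 1))).eval x ^ 2

theorem hasDerivAt_gegenbauerEnergy {α : ℝ} (hα : -1 / 2 < α) {x : ℝ} (hx : 1 - x ^ 2 ≠ 0)
    (n : ℕ) :
    HasDerivAt (gegenbauerEnergy α n)
      (4 * α * x * (derivative (gegenbauer α (n + 1))).eval x ^ 2) x := by
  have h1 := (((gegenbauer α (n + 1)).hasDerivAt x).pow 2).const_mul
    (((n : ℝ) + 1) * ((n : ℝ) + 1 + 2 * α))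
  have h2 := (((hasDerivAt_id x).pow 2).const_sub 1).mul
    (((derivative (gegenbauer α (n + 1))).hasDerivAt x).pow 2)
  refine (h1.add h2).congr_deriv ?_
  simp
  linear_combination 2 * (derivative (gegenbauer α (n + 1))).eval x * gegenbauer_ode hα hx n

theorem continuous_gegenbauerEnergy (α : ℝ) (n : ℕ) : Continuous (gegenbauerEnergy α n) := by
  unfold gegenbauerEnergy
  fun_prop

theorem mul_sq_le_gegenbauerEnergy (α : ℝ) (n : ℕ) {x : ℝ} (hx : x ∈ Set.Icc (-1 : ℝ) 1) :
    ((n : ℝ) + 1) * ((n : ℝ) + 1 + 2 * α) * (gegenbauer α (n + 1)).eval x ^ 2 ≤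
      gegenbauerEnergy α n x := by
  have : 0 ≤ 1 - x ^ 2 := by nlinarith [hx.1, hx.2]
  exact le_add_of_nonneg_right (by positivity)

theorem gegenbauerEnergy_comparison {α : ℝ} (hα : -1 / 2 < α) (n : ℕ) :
    (0 ≤ α → MonotoneOn (gegenbauerEnergy α n) (Set.Icc 0 1) ∧
      AntitoneOn (gegenbauerEnergy α n) (Set.Icc (-1) 0)) ∧
    (α ≤ 0 → AntitoneOn (gegenbauerEnergy α n) (Set.Icc 0 1) ∧
      MonotoneOn (gegenbauerEnergy α n) (Set.Icc (-1) 0)) := by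
  have hd : ∀ x ∈ Set.Ioo (-1 : ℝ) 1, HasDerivAt (gegenbauerEnergy α n)
      (4 * α * x * (derivative (gegenbauer α (n + 1))).eval x ^ 2) x := fun x hx =>
    hasDerivAt_gegenbauerEnergy hα (by nlinarith [hx.1, hx.2]) n
  have hc := continuous_gegenbauerEnergy α n
  have hr : ∀ x ∈ interior (Set.Icc (0 : ℝ) 1), x ∈ Set.Ioo (-1 : ℝ) 1 ∧ 0 ≤ x := by
    intro x hx
    rw [interior_Icc] at hx
    exact ⟨⟨by linarith [hx.1], hx.2⟩, hx.1.le⟩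
  have hl : ∀ x ∈ interior (Set.Icc (-1 : ℝ) 0), x ∈ Set.Ioo (-1 : ℝ) 1 ∧ x ≤ 0 := by
    intro x hx
    rw [interior_Icc] at hx
    exact ⟨⟨hx.1, by linarith [hx.2]⟩, hx.2.le⟩
  refine ⟨fun h => ⟨?_, ?_⟩, fun h => ⟨?_, ?_⟩⟩
  · refine monotoneOn_of_hasDerivWithinAt_nonneg (convex_Icc 0 1) hc.continuousOn
      (fun x hx => (hd x (hr x hx).1).hasDerivWithinAt) fun x hx => ?_
    exact mul_nonneg (mul_nonneg (by linarith) (hr x hx).2) (sq_nonneg _)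
  · refine antitoneOn_of_hasDerivWithinAt_nonpos (convex_Icc (-1) 0) hc.continuousOn
      (fun x hx => (hd x (hl x hx).1).hasDerivWithinAt) fun x hx => ?_
    exact mul_nonpos_of_nonpos_of_nonneg
      (mul_nonpos_of_nonneg_of_nonpos (by linarith) (hl x hx).2) (sq_nonneg _)
  · refine antitoneOn_of_hasDerivWithinAt_nonpos (convex_Icc 0 1) hc.continuousOn
      (fun x hx => (hd x (hr x hx).1).hasDerivWithinAt) fun x hx => ?_
    exact mul_nonpos_of_nonpos_of_nonneg
      (mul_nonpos_of_nonpos_of_nonneg (by linarith) (hr x hx).2) (sq_nonneg _)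
  · refine monotoneOn_of_hasDerivWithinAt_nonneg (convex_Icc (-1) 0) hc.continuousOn
      (fun x hx => (hd x (hl x hx).1).hasDerivWithinAt) fun x hx => ?_
    exact mul_nonneg (mul_nonneg_of_nonpos_of_nonpos (by linarith) (hl x hx).2) (sq_nonneg _)

theorem abs_gegenbauer_le_one {α : ℝ} (hα : 0 ≤ α) (n : ℕ) {x : ℝ}
    (hx : x ∈ Set.Icc (-1 : ℝ) 1) : |(gegenbauer α n).eval x| ≤ 1 := by
  have hα' : -1 / 2 < α := by linarith
  rcases n with _ | n
  · simp [gegenbauer]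
  have hpos : 0 < ((n : ℝ) + 1) * ((n : ℝ) + 1 + 2 * α) := by positivity
  have h := mul_sq_le_gegenbauerEnergy α n hx
  obtain ⟨hm, ha⟩ := (gegenbauerEnergy_comparison hα' n).1 hα
  have hE : gegenbauerEnergy α n x ≤ ((n : ℝ) + 1) * ((n : ℝ) + 1 + 2 * α) := by
    rcases le_total 0 x with h0 | h0
    · refine (hm ⟨h0, hx.2⟩ ⟨zero_le_one, le_rfl⟩ hx.2).trans_eq ?_
      simp [gegenbauerEnergy, (eval_gegenbauer_one hα' n).2]
    · refine (ha ⟨le_rfl, by norm_num⟩ ⟨hx.1, h0⟩ hx.1).trans_eq ?_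
      simp [gegenbauerEnergy, (eval_gegenbauer_neg_one hα' n).2, ← pow_mul, mul_comm _ 2]
  rw [← sq_le_one_iff_abs_le_one]
  exact le_of_mul_le_mul_left (by linarith) hpos

/-- For `α ≤ 0` the energy is largest at `0`, where `G_{n+1}'(0) = (n+1) G_n(0)`. -/
theorem gegenbauer_sq_le_of_nonpos {α : ℝ} (hα : -1 / 2 < α) (hα0 : α ≤ 0) (n : ℕ) {x : ℝ}
    (hx : x ∈ Set.Icc (-1 : ℝ) 1) :
    ((n : ℝ) + 1 + 2 * α) * (gegenbauer α (n + 1)).eval x ^ 2 ≤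
      ((n : ℝ) + 1 + 2 * α) * (gegenbauer α (n + 1)).eval 0 ^ 2
        + ((n : ℝ) + 1) * (gegenbauer α n).eval 0 ^ 2 := by
  have hpos : (0 : ℝ) < (n : ℝ) + 1 := by positivity
  have h := mul_sq_le_gegenbauerEnergy α n hx
  obtain ⟨ha, hm⟩ := (gegenbauerEnergy_comparison hα n).2 hα0
  have hE : gegenbauerEnergy α n x ≤ gegenbauerEnergy α n 0 := by
    rcases le_total 0 x with h0 | h0
    · exact ha ⟨le_rfl, zero_le_one⟩ ⟨h0, hx.2⟩ h0
    · exact hm ⟨hx.1, h0⟩ ⟨by norm_num, le_rfl⟩ h0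
  have hd := (one_sub_sq_mul_derivative_gegenbauer hα 0 n).2
  have hE0 : gegenbauerEnergy α n 0 = ((n : ℝ) + 1) *
      (((n : ℝ) + 1 + 2 * α) * (gegenbauer α (n + 1)).eval 0 ^ 2
        + ((n : ℝ) + 1) * (gegenbauer α n).eval 0 ^ 2) := by
    simp only [gegenbauerEnergy]
    have hd' : (derivative (gegenbauer α (n + 1))).eval 0 =
        ((n : ℝ) + 1) * (gegenbauer α n).eval 0 := by linear_combination hd
    rw [hd']
    ring
  refine le_of_mul_le_mul_left ?_ hpos
  linarith

/-! ### Uniform bounds for the node polynomial. -/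

theorem eval_zero_gegenbauer_odd {α : ℝ} (hα : -1 / 2 < α) (m : ℕ) :
    (gegenbauer α (2 * m + 1)).eval 0 = 0 := by
  induction m with
  | zero => simp [gegenbauer]
  | succ m ih =>
    have h := eval_gegenbauer_recurrence hα (2 * m + 1) 0
    rw [ih] at h
    have := natCast_succ_add_two_mul_pos hα (2 * m + 1)
    rw [mul_zero, zero_mul, mul_zero, sub_zero] at h
    exact (mul_eq_zero.1 h).resolve_left this.ne'

theorem abs_eval_zero_gegenbauer_even {α : ℝ} (hα : -1 / 2 < α) (m : ℕ) :
    (2 * (m : ℝ) + 1 + 2 * α) * |(gegenbauer α (2 * m + 2)).eval 0| =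
      (2 * (m : ℝ) + 1) * |(gegenbauer α (2 * m)).eval 0| := by
  have h := eval_gegenbauer_recurrence hα (2 * m) 0
  have h1 := natCast_succ_add_two_mul_pos hα (2 * m)
  push_cast at h h1
  rw [← abs_of_pos h1, ← abs_mul, h, ← abs_of_nonneg (by positivity : (0 : ℝ) ≤ 2 * m + 1),
    ← abs_mul, abs_of_nonneg (by positivity : (0 : ℝ) ≤ 2 * m + 1), ← abs_neg]
  congr 1
  ring

/-- Each inverse factor is `1 + α/(k+α) ≤ exp(α/(k+α)) ≤ ((k+α)/(k-1+α))^α`, and these powers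
telescope. The leading `2` pays for the first factor, `(1+2α)/(1+α) ≤ 2`. -/
theorem one_le_mul_gegenbauerLead {α : ℝ} (hα : 0 ≤ α) (n : ℕ) :
    1 ≤ 2 * (((n : ℝ) + 1 + α) / (1 + α)) ^ α * gegenbauerLead α (n + 1) := by
  induction n with
  | zero =>
    have h1 : 0 < 1 + α := by linarith
    simp only [gegenbauerLead, zero_add, Finset.prod_range_one, Nat.cast_zero, div_self h1.ne',
      Real.one_rpow]
    rw [mul_one, ← mul_div_assoc, le_div_iff₀ (by linarith)]
    linarith
  | succ n ih =>
    have hn : (0 : ℝ) ≤ n := n.cast_nonneg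
    have hs : 0 < (n : ℝ) + 1 + α := by linarith
    have hα1 : 0 < 1 + α := by linarith
    have hr : 0 < ((n : ℝ) + 2 + α) / ((n : ℝ) + 1 + α) := div_pos (by linarith) hs
    have hlog : 1 / ((n : ℝ) + 2 + α) ≤ Real.log (((n : ℝ) + 2 + α) / ((n : ℝ) + 1 + α)) := by
      refine le_trans (le_of_eq ?_) (Real.one_sub_inv_le_log_of_pos hr)
      have : (n : ℝ) + 2 + α ≠ 0 := by linarith
      field_simp
      ring
    have hp : ((n : ℝ) + 2 + 2 * α) / ((n : ℝ) + 2 + α) ≤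
        (((n : ℝ) + 2 + α) / ((n : ℝ) + 1 + α)) ^ α := by
      rw [Real.rpow_def_of_pos hr]
      refine le_trans ?_ (Real.add_one_le_exp _)
      have h2 : (n : ℝ) + 2 + α ≠ 0 := by linarith
      have h3 : ((n : ℝ) + 2 + 2 * α) / ((n : ℝ) + 2 + α) =
          1 / ((n : ℝ) + 2 + α) * α + 1 := by
        field_simp; ring
      rw [h3]
      gcongr
    have hsplit : (((n + 1 : ℕ) : ℝ) + 1 + α) / (1 + α) =
        (((n : ℝ) + 2 + α) / ((n : ℝ) + 1 + α)) * (((n : ℝ) + 1 + α) / (1 + α)) := by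
      push_cast
      field_simp
      ring
    rw [gegenbauerLead_succ, hsplit, Real.mul_rpow hr.le (by positivity)]
    have hk := gegenbauerLead_pos (show -1 / 2 < α by linarith) (n + 1)
    have hfac : 1 ≤ (((n : ℝ) + 2 + α) / ((n : ℝ) + 1 + α)) ^ α *
        (((n + 1 : ℕ) + 1 + α) / ((n + 1 : ℕ) + 1 + 2 * α)) := by
      have h4 : (1 : ℝ) = ((n : ℝ) + 2 + 2 * α) / ((n : ℝ) + 2 + α) *
          (((n + 1 : ℕ) + 1 + α) / ((n + 1 : ℕ) + 1 + 2 * α)) := by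
        push_cast
        have h2 : (n : ℝ) + 2 + α ≠ 0 := by linarith
        have h5 : (n : ℝ) + 1 + 1 + 2 * α ≠ 0 := by linarith
        field_simp
        ring
      conv_lhs => rw [h4]
      gcongr
    calc (1 : ℝ) ≤ (2 * (((n : ℝ) + 1 + α) / (1 + α)) ^ α * gegenbauerLead α (n + 1)) *
          ((((n : ℝ) + 2 + α) / ((n : ℝ) + 1 + α)) ^ α *
          (((n + 1 : ℕ) + 1 + α) / ((n + 1 : ℕ) + 1 + 2 * α))) :=
        one_le_mul_of_one_le_of_one_le ih hfac
      _ = _ := by ring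

theorem eval_radauPoly {α : ℝ} (hα : -1 / 2 < α) (n : ℕ) (t : ℝ) :
    (gegenbauer α (n + 1)).eval t - (gegenbauer α n).eval t =
      2 ^ n * gegenbauerLead α n * ∏ k, (t - fggrNode α n k) := by
  have h := congrArg (eval t) (radauPoly_eq_prod hα n)
  simpa [radauPoly, eval_prod] using h

theorem abs_prod_sub_fggrNode_le {α : ℝ} (hα : -1 / 2 < α) (n : ℕ) {t K : ℝ}
    (h0 : |(gegenbauer α n).eval t| ≤ K * gegenbauerLead α n)
    (h1 : |(gegenbauer α (n + 1)).eval t| ≤ K * gegenbauerLead α n) :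
    |∏ k, (t - fggrNode α n k)| ≤ 2 * K / 2 ^ n := by
  have hk := gegenbauerLead_pos hα n
  rw [le_div_iff₀ (by positivity)]
  refine le_of_mul_le_mul_right ?_ hk
  have h := (abs_sub _ _).trans (add_le_add h1 h0)
  rw [eval_radauPoly hα, abs_mul, abs_of_pos (by positivity)] at h
  linarith

theorem abs_prod_sub_fggrNode_le_of_nonneg {α : ℝ} (hα : 0 ≤ α) {n : ℕ} (hn : 1 ≤ n) {t : ℝ}
    (ht : t ∈ Set.Icc (-1 : ℝ) 1) :
    |∏ k, (t - fggrNode α n k)| ≤ 2 * (2 * (n : ℝ) ^ α) / 2 ^ n := by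
  have hα' : -1 / 2 < α := by linarith
  obtain ⟨m, rfl⟩ := Nat.exists_eq_add_of_le' hn
  have h : 1 ≤ 2 * ((m + 1 : ℕ) : ℝ) ^ α * gegenbauerLead α (m + 1) := by
    refine (one_le_mul_gegenbauerLead hα m).trans ?_
    have := (gegenbauerLead_pos hα' (m + 1)).le
    gcongr
    rw [div_le_iff₀ (by linarith)]
    push_cast
    nlinarith [(m.cast_nonneg : (0 : ℝ) ≤ m)]
  exact abs_prod_sub_fggrNode_le hα' _ ((abs_gegenbauer_le_one hα _ ht).trans h)
    ((abs_gegenbauer_le_one hα _ ht).trans h)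

/-- From `m` to `m + 1` the ratio `|G_{2m}(0)| / κ_{2m}` is multiplied by `(2m+1)(2m+2+2α) /
((2m+1+α)(2m+2+α)) = 1 + O(m⁻²)`, so it stays bounded. The weight `(m+1/4)/(m+5/4)` makes this
inductive: it grows by the factor `1 + 1/((m+1/4)(m+9/4))`, which dominates, and `5` normalizes it
to `1` at `m = 0`. -/
theorem abs_eval_zero_gegenbauer_even_le {α : ℝ} (hα : -1 / 2 < α) (m : ℕ) :
    |(gegenbauer α (2 * m)).eval 0| ≤
      5 * (((m : ℝ) + 1 / 4) / ((m : ℝ) + 5 / 4)) * gegenbauerLead α (2 * m) := by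
  induction m with
  | zero => norm_num [gegenbauer, gegenbauerLead]
  | succ m ih =>
    have hm : (0 : ℝ) ≤ m := m.cast_nonneg
    have hrec := abs_eval_zero_gegenbauer_even hα m
    have hk := gegenbauerLead_pos hα (2 * m)
    have h1 : 0 < 2 * (m : ℝ) + 1 + 2 * α := by linarith
    have h2 : 0 < 2 * (m : ℝ) + 2 + 2 * α := by linarith
    have hk2 : gegenbauerLead α (2 * (m + 1)) = gegenbauerLead α (2 * m) *
        ((2 * (m : ℝ) + 1 + α) * (2 * m + 2 + α) /
          ((2 * (m : ℝ) + 1 + 2 * α) * (2 * m + 2 + 2 * α))) := by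
      rw [show 2 * (m + 1) = 2 * m + 1 + 1 by ring, gegenbauerLead_succ, gegenbauerLead_succ,
        mul_assoc, div_mul_div_comm]
      push_cast
      ring_nf
    have hδ : (2 * (m : ℝ) + 1) * (2 * m + 2 + 2 * α) * (((m : ℝ) + 1 / 4) * (m + 9 / 4)) ≤
        ((m : ℝ) + 5 / 4) * (m + 5 / 4) * ((2 * (m : ℝ) + 1 + α) * (2 * m + 2 + α)) := by
      -- The denominator of the ratio exceeds its numerator by exactly `α(1+α)`.
      have hd : -α * (1 + α) ≤ 1 / 4 := by nlinarith [sq_nonneg (α + 1 / 2)]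
      have hP : 4 * (m : ℝ) ^ 2 + 4 * m + 3 / 4 ≤ (2 * (m : ℝ) + 1 + α) * (2 * m + 2 + α) := by
        nlinarith
      have hS : 0 ≤ (m : ℝ) ^ 2 + 5 / 2 * m + 9 / 16 := by positivity
      have := mul_le_mul_of_nonneg_right hd hS
      nlinarith
    have hfrac : (2 * (m : ℝ) + 1) * (((m : ℝ) + 1 / 4) / (m + 5 / 4)) ≤
        ((m : ℝ) + 5 / 4) / (m + 9 / 4) *
          ((2 * (m : ℝ) + 1 + α) * (2 * m + 2 + α) / (2 * m + 2 + 2 * α)) := by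
      rw [← mul_div_assoc, div_mul_div_comm, div_le_div_iff₀ (by positivity) (by positivity)]
      linarith
    have hcast : ((m + 1 : ℕ) : ℝ) + 1 / 4 = m + 5 / 4 ∧
        ((m + 1 : ℕ) : ℝ) + 5 / 4 = m + 9 / 4 := by
      push_cast; constructor <;> ring
    rw [hcast.1, hcast.2, hk2]
    refine le_of_mul_le_mul_left ?_ h1
    calc (2 * (m : ℝ) + 1 + 2 * α) * |(gegenbauer α (2 * (m + 1))).eval 0|
        = (2 * (m : ℝ) + 1) * |(gegenbauer α (2 * m)).eval 0| := hrec
      _ ≤ (2 * (m : ℝ) + 1) *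
          (5 * (((m : ℝ) + 1 / 4) / ((m : ℝ) + 5 / 4)) * gegenbauerLead α (2 * m)) := by gcongr
      _ = 5 * gegenbauerLead α (2 * m) *
          ((2 * (m : ℝ) + 1) * (((m : ℝ) + 1 / 4) / (m + 5 / 4))) := by ring
      _ ≤ 5 * gegenbauerLead α (2 * m) * (((m : ℝ) + 5 / 4) / (m + 9 / 4) *
          ((2 * (m : ℝ) + 1 + α) * (2 * m + 2 + α) / (2 * m + 2 + 2 * α))) := by gcongr
      _ = _ := by
        generalize 2 * (m : ℝ) + 1 + 2 * α = d at h1 ⊢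
        have h1' := h1.ne'
        field_simp

theorem abs_gegenbauer_le_of_nonpos {α : ℝ} (hα : -1 / 2 < α) (hα0 : α ≤ 0) (m : ℕ) {x : ℝ}
    (hx : x ∈ Set.Icc (-1 : ℝ) 1) :
    |(gegenbauer α (2 * m)).eval x| ≤ |(gegenbauer α (2 * m)).eval 0| ∧
      |(gegenbauer α (2 * m + 1)).eval x| ≤
        |(gegenbauer α (2 * m)).eval 0| / (1 + 2 * α) := by
  have hc : 0 < 1 + 2 * α := by linarith
  constructor
  · rcases m with _ | m
    · simp [gegenbauer]
    have h := gegenbauer_sq_le_of_nonpos hα hα0 (2 * m + 1) hx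
    have hp := natCast_succ_add_two_mul_pos hα (2 * m + 1)
    rw [eval_zero_gegenbauer_odd hα, zero_pow two_ne_zero, mul_zero, add_zero] at h
    exact sq_le_sq.1 (le_of_mul_le_mul_left h hp)
  · have h := gegenbauer_sq_le_of_nonpos hα hα0 (2 * m) hx
    rw [eval_zero_gegenbauer_odd hα, zero_pow two_ne_zero, mul_zero, zero_add] at h
    rw [show |(gegenbauer α (2 * m)).eval 0| / (1 + 2 * α) =
      |(gegenbauer α (2 * m)).eval 0 / (1 + 2 * α)| by rw [abs_div, abs_of_pos hc], ← sq_le_sq,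
      div_pow, le_div_iff₀ (by positivity)]
    have hm : (0 : ℝ) ≤ ((2 * m : ℕ) : ℝ) := Nat.cast_nonneg _
    have h3 : (1 + 2 * α) * (gegenbauer α (2 * m + 1)).eval x ^ 2 ≤
        (gegenbauer α (2 * m)).eval 0 ^ 2 := by
      refine le_of_mul_le_mul_left (le_trans ?_ h) (by linarith : (0 : ℝ) < (2 * m : ℕ) + 1)
      rw [← mul_assoc]
      refine mul_le_mul_of_nonneg_right ?_ (sq_nonneg _)
      nlinarith
    -- Since `1 + 2α ≤ 1`, the natural constant `(1+2α)^(-1/2)` may be weakened to `(1+2α)⁻¹`.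
    nlinarith [sq_nonneg ((gegenbauer α (2 * m + 1)).eval x),
      mul_nonneg hc.le (sq_nonneg ((gegenbauer α (2 * m + 1)).eval x))]

theorem abs_gegenbauer_le_mul_lead {α : ℝ} (hα : -1 / 2 < α) (hα0 : α ≤ 0) (n : ℕ) {x : ℝ}
    (hx : x ∈ Set.Icc (-1 : ℝ) 1) :
    |(gegenbauer α n).eval x| ≤ 5 / (1 + 2 * α) * gegenbauerLead α n ∧
      |(gegenbauer α (n + 1)).eval x| ≤ 5 / (1 + 2 * α) * gegenbauerLead α n := by
  have hc : 0 < 1 + 2 * α := by linarith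
  have hg : ∀ m : ℕ, |(gegenbauer α (2 * m)).eval 0| / (1 + 2 * α) ≤
      5 / (1 + 2 * α) * gegenbauerLead α (2 * m) := by
    intro m
    have hk := gegenbauerLead_pos hα (2 * m)
    rw [div_mul_eq_mul_div]
    refine div_le_div_of_nonneg_right ?_ hc.le
    refine (abs_eval_zero_gegenbauer_even_le hα m).trans ?_
    refine mul_le_mul_of_nonneg_right ?_ hk.le
    have : ((m : ℝ) + 1 / 4) / ((m : ℝ) + 5 / 4) ≤ 1 :=
      div_le_one_of_le₀ (by linarith) (by positivity)
    linarith
  have hle : ∀ m : ℕ, |(gegenbauer α (2 * m)).eval 0| ≤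
      |(gegenbauer α (2 * m)).eval 0| / (1 + 2 * α) := fun m =>
    le_div_self (abs_nonneg _) hc (by linarith)
  obtain ⟨m, rfl | rfl⟩ := Nat.even_or_odd' n
  · obtain ⟨h1, h2⟩ := abs_gegenbauer_le_of_nonpos hα hα0 m hx
    exact ⟨(h1.trans (hle m)).trans (hg m), h2.trans (hg m)⟩
  -- For `α ≤ 0` every factor of `κ` is at least `1`, so a bound by `κ_{2m}` passes to `κ_{2m+1}`.
  · have hk : gegenbauerLead α (2 * m) ≤ gegenbauerLead α (2 * m + 1) := by
      rw [gegenbauerLead_succ]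
      refine le_mul_of_one_le_right (gegenbauerLead_pos hα _).le ?_
      rw [one_le_div (natCast_succ_add_two_mul_pos hα _)]
      linarith
    have hg' := (hg m).trans (mul_le_mul_of_nonneg_left hk (by positivity))
    refine ⟨(abs_gegenbauer_le_of_nonpos hα hα0 m hx).2.trans hg', ?_⟩
    refine ((abs_gegenbauer_le_of_nonpos hα hα0 (m + 1) hx).1.trans ?_).trans hg'
    rw [le_div_iff₀ hc]
    have hrec := abs_eval_zero_gegenbauer_even hα m
    have hm : (0 : ℝ) ≤ m := m.cast_nonneg
    refine le_of_mul_le_mul_left ?_ (by linarith : 0 < 2 * (m : ℝ) + 1)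
    rw [← hrec]
    change _ * (|(gegenbauer α (2 * m + 2)).eval 0| * _) ≤ _
    have := mul_nonneg (mul_nonneg hm (neg_nonneg.2 hα0))
      (abs_nonneg ((gegenbauer α (2 * m + 2)).eval 0))
    linarith

theorem abs_prod_sub_fggrNode_le_of_nonpos {α : ℝ} (hα : -1 / 2 < α) (hα0 : α ≤ 0) (n : ℕ)
    {t : ℝ} (ht : t ∈ Set.Icc (-1 : ℝ) 1) :
    |∏ k, (t - fggrNode α n k)| ≤ 2 * (5 / (1 + 2 * α)) / 2 ^ n :=
  abs_prod_sub_fggrNode_le hα n (abs_gegenbauer_le_mul_lead hα hα0 n ht).1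
    (abs_gegenbauer_le_mul_lead hα hα0 n ht).2

theorem abs_prod_sub_fggrNode_le_two_pow {α : ℝ} (hα : -1 / 2 < α) (n : ℕ) {t : ℝ}
    (ht : t ∈ Set.Icc (-1 : ℝ) 1) :
    |∏ k, (t - fggrNode α n k)| ≤ 2 ^ (n + 1) := by
  rw [Finset.abs_prod]
  refine (Finset.prod_le_prod (g := fun _ => (2 : ℝ)) (fun k _ => abs_nonneg _)
    fun k _ => ?_).trans_eq (by simp)
  obtain ⟨h1, h2⟩ := fggrNode_mem_Ioc hα n k
  exact abs_le.2 ⟨by linarith [ht.1], by linarith [ht.2]⟩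

/-! ### Rolle's theorem and the interpolation error. -/

/-- Generalized Rolle theorem: if `F 0` has `m + 1` zeros in `S` and `F (k + 1)` is the derivative
of `F k` within `S` for `k < m`, then `F m` has a zero in `S`. -/
theorem exists_zero_of_hasDerivWithinAt_chain {S : Set ℝ} [hS : S.OrdConnected] (m : ℕ)
    (F : ℕ → ℝ → ℝ)
    (hF : ∀ k < m, ∀ x ∈ S, HasDerivWithinAt (F k) (F (k + 1) x) S x)
    (s : Finset ℝ) (hsS : ∀ x ∈ s, x ∈ S) (hs : s.card = m + 1) (h0 : ∀ x ∈ s, F 0 x = 0) :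
    ∃ ξ ∈ S, F m ξ = 0 := by
  induction m generalizing F s with
  | zero =>
    obtain ⟨x, hx⟩ := Finset.card_pos.1 (by lia : 0 < s.card)
    exact ⟨x, hsS x hx, h0 x hx⟩
  | succ m ih =>
    let a := s.orderEmbOfFin hs
    have ha : ∀ i, a i ∈ s := s.orderEmbOfFin_mem hs
    have hrolle : ∀ i : Fin (m + 1), ∃ c ∈ Set.Ioo (a i.castSucc) (a i.succ), F 1 c = 0 := by
      intro i
      have hsub : Set.Icc (a i.castSucc) (a i.succ) ⊆ S :=
        hS.out (hsS _ (ha _)) (hsS _ (ha _))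
      refine exists_hasDerivAt_eq_zero (f := F 0) (a.strictMono i.castSucc_lt_succ)
        (fun x hx => ((hF 0 (by lia) x (hsub hx)).mono hsub).continuousWithinAt)
        ((h0 _ (ha _)).trans (h0 _ (ha _)).symm) fun x hx => ?_
      exact (hF 0 (by lia) x (hsub ⟨hx.1.le, hx.2.le⟩)).hasDerivAt
        (Filter.mem_of_superset (Icc_mem_nhds hx.1 hx.2) hsub)
    choose c hc hc0 using hrolle
    have hmono : StrictMono c := by
      intro i j hij
      exact (hc i).2.trans_le ((a.monotone (Fin.succ_le_castSucc_iff.2 hij)).trans (hc j).1.le)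
    refine ih (fun k => F (k + 1)) (fun k hk => hF (k + 1) (by lia))
      (Finset.univ.image c) ?_ ?_ ?_
    · intro x hx
      obtain ⟨i, -, rfl⟩ := Finset.mem_image.1 hx
      exact hS.out (hsS _ (ha _)) (hsS _ (ha _)) ⟨(hc i).1.le, (hc i).2.le⟩
    · simp [Finset.card_image_of_injective _ hmono.injective]
    · intro x hx
      obtain ⟨i, -, rfl⟩ := Finset.mem_image.1 hx
      exact hc0 i

theorem iterate_derivative_of_monic_natDegree {p : ℝ[X]} (hp : p.Monic) {n : ℕ}
    (hn : p.natDegree = n) (x : ℝ) : (derivative^[n] p).eval x = (n.factorial : ℝ) := by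
  have hd : (derivative^[n] p).natDegree = 0 := by
    have := natDegree_iterate_derivative p n
    lia
  rw [eq_C_of_natDegree_eq_zero hd, eval_C, coeff_iterate_derivative, zero_add, ← hn,
    hp.coeff_natDegree, Nat.descFactorial_self]
  simp

/-- The error of Lagrange interpolation. -/
theorem abs_sub_interpolant_le {S : Set ℝ} [S.OrdConnected] {n : ℕ} {F : ℕ → ℝ → ℝ}
    (hF : ∀ k < n + 1, ∀ x ∈ S, HasDerivWithinAt (F k) (F (k + 1) x) S x)
    {D : ℝ} (hD : ∀ x ∈ S, |F (n + 1) x| ≤ D)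
    {v : Fin (n + 1) → ℝ} (hv : Function.Injective v) (hvS : ∀ k, v k ∈ S)
    {P : ℝ[X]} (hP : P.natDegree ≤ n) (hPv : ∀ k, P.eval (v k) = F 0 (v k))
    {x : ℝ} (hx : x ∈ S) :
    |F 0 x - P.eval x| ≤ D / (n + 1).factorial * |∏ k, (x - v k)| := by
  have hD0 : 0 ≤ D := (abs_nonneg _).trans (hD x hx)
  by_cases hxv : ∃ k, x = v k
  · obtain ⟨k, rfl⟩ := hxv
    rw [hPv, sub_self, abs_zero]
    positivity
  push Not at hxv
  have hw : ∏ k, (x - v k) ≠ 0 :=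
    Finset.prod_ne_zero_iff.2 fun k _ => sub_ne_zero.2 (hxv k)
  let W : ℝ[X] := Lagrange.nodal Finset.univ v
  -- With this `c`, `F 0 - P - c W` vanishes at `x` as well as at the `n + 1` nodes; a zero of its
  -- derivative of order `n + 1` gives `F (n+1) ξ = c (n+1)!`.
  set c := (F 0 x - P.eval x) / ∏ k, (x - v k) with hc
  let E : ℕ → ℝ → ℝ := fun k t =>
    F k t - (derivative^[k] P).eval t - c * (derivative^[k] W).eval t
  obtain ⟨ξ, hξS, hξ⟩ : ∃ ξ ∈ S, E (n + 1) ξ = 0 := by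
    refine exists_zero_of_hasDerivWithinAt_chain (n + 1) E ?_
      (insert x (Finset.univ.image v)) ?_ ?_ ?_
    · intro k hk t ht
      have h1 := (derivative^[k] P).hasDerivAt t
      have h2 := (derivative^[k] W).hasDerivAt t
      rw [← Function.iterate_succ_apply' derivative] at h1 h2
      exact ((hF k hk t ht).sub h1.hasDerivWithinAt).sub (h2.hasDerivWithinAt.const_mul c)
    · intro t ht
      rcases Finset.mem_insert.1 ht with rfl | ht
      · exact hx
      · obtain ⟨k, -, rfl⟩ := Finset.mem_image.1 ht
        exact hvS k
    · rw [Finset.card_insert_of_notMem, Finset.card_image_of_injective _ hv, Finset.card_univ,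
        Fintype.card_fin]
      simpa [eq_comm] using hxv
    · intro t ht
      rcases Finset.mem_insert.1 ht with rfl | ht
      · simp [E, W, Lagrange.eval_nodal, hc, div_mul_cancel₀ _ hw]
      · obtain ⟨k, -, rfl⟩ := Finset.mem_image.1 ht
        simp [E, W, hPv, Lagrange.eval_nodal_at_node]
  simp only [E] at hξ
  rw [iterate_derivative_eq_zero (by lia), eval_zero,
    iterate_derivative_of_monic_natDegree Lagrange.nodal_monic
      (by simp [Lagrange.natDegree_nodal]), sub_zero, sub_eq_zero] at hξ
  have hfac : (0 : ℝ) < (n + 1).factorial := by positivity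
  have hcD : |c| ≤ D / (n + 1).factorial := by
    rw [le_div_iff₀ hfac, ← abs_of_pos hfac, ← abs_mul, ← hξ]
    exact hD ξ hξS
  calc |F 0 x - P.eval x| = |c| * |∏ k, (x - v k)| := by
        rw [← abs_mul, hc, div_mul_cancel₀ _ hw]
    _ ≤ _ := by gcongr

/-! ### Quadrature error of the integration matrix. -/

/-- The mean value inequality on `[s, x]` with `s → 0⁺`; a limit at `0` replaces differentiability
there. The factor `x` later cancels `1 / x` in the equation. -/
theorem abs_sub_le_of_hasDerivWithinAt_Ioc {b η L : ℝ} {f f' : ℝ → ℝ}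
    (hf : ∀ x ∈ Set.Ioc 0 b, HasDerivWithinAt f (f' x) (Set.Ioc 0 b) x)
    (hη : ∀ x ∈ Set.Ioc 0 b, |f' x| ≤ η)
    (hL : Filter.Tendsto f (nhdsWithin 0 (Set.Ioi 0)) (nhds L)) {x : ℝ} (hx : x ∈ Set.Ioc 0 b) :
    |L - f x| ≤ x * η := by
  have hη0 : 0 ≤ η := (abs_nonneg _).trans (hη x hx)
  refine le_of_tendsto (hL.sub_const (f x)).abs ?_
  filter_upwards [Ioc_mem_nhdsGT hx.1] with s hs
  have h := (convex_Ioc 0 b).norm_image_sub_le_of_norm_hasDerivWithin_le hf hη hx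
    ⟨hs.1, hs.2.trans hx.2⟩
  rw [Real.norm_eq_abs, Real.norm_eq_abs, abs_sub_comm s, abs_of_nonneg (sub_nonneg.2 hs.2)] at h
  nlinarith [hs.1]

theorem sfggrNode_injective {α b : ℝ} (hα : -1 / 2 < α) (hb : 0 < b) (n : ℕ) :
    Function.Injective (sfggrNode α b n) := by
  intro i j h
  have h' := mul_left_cancel₀ (by positivity : b / 2 ≠ 0) h
  exact fggrNode_injective hα n (add_right_cancel h')

theorem sfggrNode_mem_Ioc {α b : ℝ} (hα : -1 / 2 < α) (hb : 0 < b) (n : ℕ) (k : Fin (n + 1)) :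
    sfggrNode α b n k ∈ Set.Ioc 0 b := by
  obtain ⟨h1, h2⟩ := fggrNode_mem_Ioc hα n k
  have hb2 : 0 < b / 2 := by positivity
  refine ⟨mul_pos hb2 (by linarith), ?_⟩
  have := mul_le_mul_of_nonneg_left (by linarith : fggrNode α n k + 1 ≤ 2) hb2.le
  unfold sfggrNode
  linarith

theorem shiftedIntMatrix₁_mulVec (α b : ℝ) (n : ℕ) (r : Fin (n + 1) → ℝ) (i : Fin (n + 1)) :
    (shiftedIntMatrix₁ α b n).mulVec r i =
      b / 2 * ∫ t in (-1 : ℝ)..fggrNode α n i,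
        (Lagrange.interpolate Finset.univ (fggrNode α n) r).eval t := by
  have hint : ∀ k ∈ Finset.univ, IntervalIntegrable (fun t => r k *
      (Lagrange.basis Finset.univ (fggrNode α n) k).eval t) MeasureTheory.volume (-1)
      (fggrNode α n i) := fun k _ =>
    (continuous_const.mul
      (Lagrange.basis Finset.univ (fggrNode α n) k).continuous).intervalIntegrable _ _
  simp only [Lagrange.interpolate_apply, eval_finsetSum, eval_mul, eval_C]
  rw [intervalIntegral.integral_finsetSum hint]
  simp only [intervalIntegral.integral_const_mul, shiftedIntMatrix₁, intMatrix, Matrix.mulVec,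
    dotProduct, Matrix.smul_apply, Matrix.of_apply, smul_eq_mul, Finset.mul_sum]
  exact Finset.sum_congr rfl fun k _ => by ring

/-- The quadrature error of the shifted integration matrix for the derivative `F 0` of `H`. -/
theorem abs_shiftedIntMatrix₁_mulVec_sub_le {α b : ℝ} (hα : -1 / 2 < α) (hb : 0 < b) {n : ℕ}
    {F : ℕ → ℝ → ℝ}
    (hF : ∀ k < n + 1, ∀ x ∈ Set.Ioc 0 b, HasDerivWithinAt (F k) (F (k + 1) x) (Set.Ioc 0 b) x)
    {D Ω L : ℝ} (hD : ∀ x ∈ Set.Ioc 0 b, |F (n + 1) x| ≤ D)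
    (hΩ : ∀ t ∈ Set.Icc (-1 : ℝ) 1, |∏ k, (t - fggrNode α n k)| ≤ Ω)
    {H : ℝ → ℝ} (hH : ∀ x ∈ Set.Ioc 0 b, HasDerivWithinAt H (F 0 x) (Set.Ioc 0 b) x)
    (hL : Filter.Tendsto H (nhdsWithin 0 (Set.Ioi 0)) (nhds L)) (i : Fin (n + 1)) :
    |L + (shiftedIntMatrix₁ α b n).mulVec (fun k => F 0 (sfggrNode α b n k)) i
        - H (sfggrNode α b n i)| ≤
      sfggrNode α b n i * (D / (n + 1).factorial * ((b / 2) ^ (n + 1) * Ω)) := by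
  set P := Lagrange.interpolate Finset.univ (fggrNode α n) (fun k => F 0 (sfggrNode α b n k))
  have hnode : ∀ k, 2 / b * sfggrNode α b n k - 1 = fggrNode α n k := fun k => by
    unfold sfggrNode
    field_simp
    ring
  have hPdeg : P.natDegree ≤ n := by
    have := Lagrange.degree_interpolate_lt (fun k => F 0 (sfggrNode α b n k))
      (fggrNode_injective hα n).injOn (s := Finset.univ)
    rw [Finset.card_univ, Fintype.card_fin] at this
    exact natDegree_le_of_degree_le (Order.lt_succ_iff.1 (by exact_mod_cast this))
  -- The antiderivative, zero at `0`, of the interpolant transported to `[0, b]`. Thus `H - S` has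
  -- the interpolation error as derivative and the limit `L` at `0`.
  let S : ℝ → ℝ := fun x => b / 2 * ∫ t in (-1 : ℝ)..(2 / b * x - 1), P.eval t
  have hS : ∀ x, HasDerivAt S ((P.comp (C (2 / b) * X - 1)).eval x) x := by
    intro x
    have h1 : HasDerivAt (fun u => ∫ t in (-1 : ℝ)..u, P.eval t) (P.eval (2 / b * x - 1))
        (2 / b * x - 1) := (P.continuous.integral_hasStrictDerivAt _ _).hasDerivAt
    have h2 : HasDerivAt (fun x : ℝ => 2 / b * x - 1) (2 / b * 1) x :=
      ((hasDerivAt_id x).const_mul (2 / b)).sub_const 1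
    refine ((h1.comp x h2).const_mul (b / 2)).congr_deriv ?_
    simp only [eval_comp, eval_sub, eval_mul, eval_C, eval_X, eval_one]
    field_simp
  have hS0 : S 0 = 0 := by simp [S]
  have hSi : (shiftedIntMatrix₁ α b n).mulVec (fun k => F 0 (sfggrNode α b n k)) i =
      S (sfggrNode α b n i) := by
    rw [shiftedIntMatrix₁_mulVec]
    simp only [S, hnode, P]
  have hη : ∀ x ∈ Set.Ioc 0 b, |F 0 x - (P.comp (C (2 / b) * X - 1)).eval x| ≤
      D / (n + 1).factorial * ((b / 2) ^ (n + 1) * Ω) := by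
    intro x hx
    have hD0 : 0 ≤ D := (abs_nonneg _).trans (hD x hx)
    refine (abs_sub_interpolant_le hF hD (sfggrNode_injective hα hb n)
      (sfggrNode_mem_Ioc hα hb n) ?_ ?_ hx).trans ?_
    · refine natDegree_comp_le.trans ?_
      have h1 : (C (2 / b) * X - 1 : ℝ[X]).natDegree ≤ 1 := by
        compute_degree
      calc _ ≤ n * 1 := Nat.mul_le_mul hPdeg h1
        _ = n := mul_one n
    · intro k
      simp only [eval_comp, eval_sub, eval_mul, eval_C, eval_X, eval_one, hnode]
      exact Lagrange.eval_interpolate_at_node _ (fggrNode_injective hα n).injOn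
        (Finset.mem_univ k)
    · refine mul_le_mul_of_nonneg_left ?_ (by positivity)
      have hprod : ∏ k, (x - sfggrNode α b n k) =
          (b / 2) ^ (n + 1) * ∏ k, ((2 / b * x - 1) - fggrNode α n k) := by
        have hpow : (b / 2) ^ (n + 1) = ∏ _k : Fin (n + 1), b / 2 := by
          rw [Finset.prod_const, Finset.card_univ, Fintype.card_fin]
        rw [hpow, ← Finset.prod_mul_distrib]
        refine Finset.prod_congr rfl fun k _ => ?_
        unfold sfggrNode
        field_simp
        ring
      rw [hprod, abs_mul, abs_of_nonneg (by positivity)]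
      refine mul_le_mul_of_nonneg_left (hΩ _ ⟨?_, ?_⟩) (by positivity)
      · have := mul_pos (by positivity : 0 < 2 / b) hx.1
        linarith
      · have : 2 / b * x ≤ 2 / b * b := mul_le_mul_of_nonneg_left hx.2 (by positivity)
        rw [div_mul_cancel₀ _ hb.ne'] at this
        linarith
  have hlim : Filter.Tendsto (fun x => H x - S x) (nhdsWithin 0 (Set.Ioi 0)) (nhds L) := by
    have h := hL.sub ((hS 0).continuousAt.tendsto.mono_left nhdsWithin_le_nhds)
    rwa [hS0, sub_zero] at h
  have h := abs_sub_le_of_hasDerivWithinAt_Ioc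
    (fun x hx => (hH x hx).sub (hS x).hasDerivWithinAt) hη hlim (sfggrNode_mem_Ioc hα hb n i)
  rw [hSi]
  convert h using 2
  simp only [Pi.sub_apply]
  ring

/-! ### Residual of the exact solution. -/

theorem hasDerivWithinAt_iteratedDerivWithin_Ioc {b : ℝ} {y : ℝ → ℝ}
    (hy : ContDiffOn ℝ (⊤ : ℕ∞) y (Set.Ioc 0 b)) (k : ℕ) {x : ℝ} (hx : x ∈ Set.Ioc 0 b) :
    HasDerivWithinAt (iteratedDerivWithin k y (Set.Ioc 0 b))
      (iteratedDerivWithin (k + 1) y (Set.Ioc 0 b) x) (Set.Ioc 0 b) x := by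
  rw [iteratedDerivWithin_succ]
  exact (hy.differentiableOn_iteratedDerivWithin (m := k) (by exact_mod_cast ENat.natCast_lt_top k)
    (uniqueDiffOn_Ioc 0 b) x hx).hasDerivWithinAt

/-- If `y` has derivative `a` at `0` from the right and a bounded second derivative on `(0, b]`,
then its first derivative tends to `a` at `0`. -/
theorem tendsto_of_hasDerivWithinAt_zero {b a K : ℝ} (hb : 0 < b) {y y' y'' : ℝ → ℝ}
    (hy : ∀ x ∈ Set.Ioc 0 b, HasDerivWithinAt y (y' x) (Set.Ioc 0 b) x)
    (hy' : ∀ x ∈ Set.Ioc 0 b, HasDerivWithinAt y' (y'' x) (Set.Ioc 0 b) x)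
    (hK : ∀ x ∈ Set.Ioc 0 b, |y'' x| ≤ K)
    (h0 : HasDerivWithinAt y a (Set.Icc 0 b) 0) :
    Filter.Tendsto y' (nhdsWithin 0 (Set.Ioi 0)) (nhds a) := by
  have hK0 : 0 ≤ K := (abs_nonneg _).trans (hK b ⟨hb, le_rfl⟩)
  have hslope : Filter.Tendsto (slope y 0) (nhdsWithin 0 (Set.Ioi 0)) (nhds a) := by
    rw [hasDerivWithinAt_iff_tendsto_slope] at h0
    refine h0.mono_left (nhdsWithin_le_of_mem ?_)
    exact Filter.mem_of_superset (Ioc_mem_nhdsGT hb) fun x hx => ⟨⟨hx.1.le, hx.2⟩, hx.1.ne'⟩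
  have hdiff : Filter.Tendsto (fun s => y' s - slope y 0 s) (nhdsWithin 0 (Set.Ioi 0))
      (nhds 0) := by
    have hlim : Filter.Tendsto (fun s : ℝ => K * s) (nhdsWithin 0 (Set.Ioi 0)) (nhds 0) := by
      have h : Filter.Tendsto (fun s : ℝ => K * s) (nhds 0) (nhds (K * 0)) :=
        (continuous_const.mul continuous_id).tendsto 0
      rw [mul_zero] at h
      exact h.mono_left nhdsWithin_le_nhds
    refine squeeze_zero_norm' ?_ hlim
    filter_upwards [Ioc_mem_nhdsGT hb] with s hs
    -- The slope on `[0, s]` is `y' ξ` with `0 < ξ < s`, so it differs from `y' s` by at most `K s`.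
    obtain ⟨ξ, hξ, hξs⟩ := exists_hasDerivAt_eq_slope y y' hs.1
      (by
        intro x hx
        rcases hx.1.eq_or_lt with rfl | hx0
        · exact h0.continuousWithinAt.mono (Set.Icc_subset_Icc_right hs.2)
        · have hxb : x ∈ Set.Ioc 0 b := ⟨hx0, hx.2.trans hs.2⟩
          refine (hy x hxb).continuousWithinAt.mono_of_mem_nhdsWithin ?_
          have h1 : Set.Ioi (0 : ℝ) ∈ nhdsWithin x (Set.Icc 0 s) :=
            mem_nhdsWithin_of_mem_nhds (Ioi_mem_nhds hx0)
          filter_upwards [h1, self_mem_nhdsWithin] with t ht1 ht2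
          exact ⟨ht1, ht2.2.trans hs.2⟩)
      (fun x hx => (hy x ⟨hx.1, hx.2.le.trans hs.2⟩).hasDerivAt
        (Filter.mem_of_superset (Ioo_mem_nhds hx.1 hx.2)
          fun t ht => ⟨ht.1, ht.2.le.trans hs.2⟩))
    have hξb : ξ ∈ Set.Ioc 0 b := ⟨hξ.1, hξ.2.le.trans hs.2⟩
    have h := (convex_Ioc 0 b).norm_image_sub_le_of_norm_hasDerivWithin_le hy' hK hξb hs
    have hsl : slope y 0 s = y' ξ := by rw [slope_def_field, hξs]
    rw [hsl]
    refine h.trans (mul_le_mul_of_nonneg_left ?_ hK0)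
    rw [Real.norm_eq_abs, abs_of_nonneg (by linarith [hξ.2])]
    linarith [hξ.1]
  simpa using hslope.add hdiff

theorem abs_nodalResidual_le {α α₂ A b α₁ β γ δ M Ω : ℝ} (hα : -1 / 2 < α) {p g y : ℝ → ℝ}
    (hb : 0 < b) (hsol : IsLaneEmdenSolution b α₁ α₂ β γ δ p g y)
    (hy : ContDiffOn ℝ (⊤ : ℕ∞) y (Set.Ioc 0 b))
    (hA : ∀ n : ℕ, ∀ x ∈ Set.Ioc 0 b, |iteratedDerivWithin (n + 3) y (Set.Ioc 0 b) x| ≤ A)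
    (hM : ∀ x ∈ Set.Ioc 0 b, |p x| ≤ M) {n : ℕ} (hn : 1 ≤ n)
    (hΩ : ∀ t ∈ Set.Icc (-1 : ℝ) 1, |∏ k, (t - fggrNode α n k)| ≤ Ω) (i : Fin (n + 1)) :
    |nodalResidual α b α₁ α₂ n p g
        (fun k => iteratedDerivWithin 2 y (Set.Ioc 0 b) (sfggrNode α b n k)) (y 0) i| ≤
      M * (b * ((b * A + ((n : ℝ) + 1) * A) / (n + 1).factorial * b ^ (n + 1)))
        + |α₂| * (A / (n + 1).factorial * ((b / 2) ^ (n + 1) * Ω)) := by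
  set Y : ℕ → ℝ → ℝ := fun k => iteratedDerivWithin k y (Set.Ioc 0 b) with hYdef
  have hY : ∀ k, ∀ x ∈ Set.Ioc 0 b, HasDerivWithinAt (Y k) (Y (k + 1) x) (Set.Ioc 0 b) x :=
    fun k x hx => hasDerivWithinAt_iteratedDerivWithin_Ioc hy k hx
  have hY0 : Y 0 = y := iteratedDerivWithin_zero
  have hy1 : ∀ x ∈ Set.Ioc 0 b, HasDerivWithinAt y (Y 1 x) (Set.Ioc 0 b) x := fun x hx => by
    simpa only [hY0] using hY 0 x hx
  have hbb : b ∈ Set.Ioc 0 b := ⟨hb, le_rfl⟩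
  have hA0 : 0 ≤ A := (abs_nonneg _).trans (hA 0 b hbb)
  -- Only derivatives of order at least `3` are bounded by hypothesis; integrating back from `b`
  -- bounds `y''`, which gives `y'` its limit at `0`.
  have hY2 : ∀ x ∈ Set.Ioc 0 b, |Y 2 x| ≤ |Y 2 b| + A * b := by
    intro x hx
    have h := (convex_Ioc 0 b).norm_image_sub_le_of_norm_hasDerivWithin_le (hY 2) (hA 0) hbb hx
    rw [Real.norm_eq_abs, Real.norm_eq_abs] at h
    have h1 : |x - b| ≤ b := abs_le.2 ⟨by linarith [hx.1], by linarith [hx.2]⟩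
    have h2 := mul_le_mul_of_nonneg_left h1 hA0
    have h3 := abs_sub_abs_le_abs_sub (Y 2 x) (Y 2 b)
    linarith
  have hlim1 : Filter.Tendsto (Y 1) (nhdsWithin 0 (Set.Ioi 0)) (nhds α₁) :=
    tendsto_of_hasDerivWithinAt_zero hb hy1 (hY 1) hY2 hsol.deriv_zero
  have hlim0 : Filter.Tendsto y (nhdsWithin 0 (Set.Ioi 0)) (nhds (y 0)) :=
    hsol.deriv_zero.continuousWithinAt.tendsto.mono_left (nhdsWithin_le_of_mem
      (Filter.mem_of_superset (Ioc_mem_nhdsGT hb) Set.Ioc_subset_Icc_self))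
  set xi := sfggrNode α b n i with hxi
  have hxi_mem : xi ∈ Set.Ioc 0 b := sfggrNode_mem_Ioc hα hb n i
  have herr1 : |α₁ + (shiftedIntMatrix₁ α b n).mulVec (fun k => Y 2 (sfggrNode α b n k)) i
      - Y 1 xi| ≤ xi * (A / (n + 1).factorial * ((b / 2) ^ (n + 1) * Ω)) :=
    abs_shiftedIntMatrix₁_mulVec_sub_le hα hb (F := fun k => Y (k + 2))
      (fun k _ x hx => hY (k + 2) x hx) (fun x hx => hA n x hx) hΩ (hY 1) hlim1 i
  -- `F k` is the `k`-th derivative of `(xi - t) y''(t)`, by Leibniz's rule.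
  let F : ℕ → ℝ → ℝ := fun k t => (xi - t) * Y (k + 2) t - k * Y (k + 1) t
  have hF : ∀ k, ∀ x ∈ Set.Ioc 0 b, HasDerivWithinAt (F k) (F (k + 1) x) (Set.Ioc 0 b) x := by
    intro k x hx
    have h1 := ((hasDerivWithinAt_id x (Set.Ioc 0 b)).const_sub xi).mul (hY (k + 2) x hx)
    refine (h1.sub ((hY (k + 1) x hx).const_mul (k : ℝ))).congr_deriv ?_
    simp only [F, id]
    push_cast
    ring
  have hFD : ∀ x ∈ Set.Ioc 0 b, |F (n + 1) x| ≤ b * A + ((n : ℝ) + 1) * A := by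
    intro x hx
    -- `F (n+1)` involves the derivative of order `n + 2`, which the hypothesis covers only when `n
    -- ≥ 1`.
    obtain ⟨m, rfl⟩ := Nat.exists_eq_add_of_le' hn
    have h1 : |(xi - x) * Y (m + 1 + 1 + 2) x| ≤ b * A := by
      rw [abs_mul]
      refine mul_le_mul ?_ (hA (m + 1) x hx) (abs_nonneg _) hb.le
      exact abs_le.2 ⟨by linarith [hx.2, hxi_mem.1], by linarith [hx.1, hxi_mem.2]⟩
    have h2 : |((m + 1 + 1 : ℕ) : ℝ) * Y (m + 1 + 1 + 1) x| ≤ (((m + 1 : ℕ) : ℝ) + 1) * A := by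
      rw [abs_mul, Nat.abs_cast]
      push_cast
      exact mul_le_mul_of_nonneg_left (hA m x hx) (by positivity)
    exact (abs_sub _ _).trans (add_le_add h1 h2)
  have hH : ∀ x ∈ Set.Ioc 0 b,
      HasDerivWithinAt (fun t => (xi - t) * Y 1 t + y t) (F 0 x) (Set.Ioc 0 b) x := by
    intro x hx
    have h1 := ((hasDerivWithinAt_id x (Set.Ioc 0 b)).const_sub xi).mul (hY 1 x hx)
    refine (h1.add (hy1 x hx)).congr_deriv ?_
    simp only [F, id]
    push_cast
    ring
  have hHlim : Filter.Tendsto (fun t => (xi - t) * Y 1 t + y t) (nhdsWithin 0 (Set.Ioi 0))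
      (nhds ((xi - 0) * α₁ + y 0)) := by
    have hid : Filter.Tendsto (fun t : ℝ => xi - t) (nhdsWithin 0 (Set.Ioi 0))
        (nhds (xi - 0)) :=
      ((continuous_const.sub continuous_id).tendsto 0).mono_left nhdsWithin_le_nhds
    exact (hid.mul hlim1).add hlim0
  have herr2 := abs_shiftedIntMatrix₁_mulVec_sub_le hα hb (fun k _ x hx => hF k x hx) hFD
    (fun t ht => abs_prod_sub_fggrNode_le_two_pow hα n ht) hH hHlim i
  have hyApp : yApp α b α₁ n (fun k => Y 2 (sfggrNode α b n k)) (y 0) i - y xi =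
      (xi - 0) * α₁ + y 0 + (shiftedIntMatrix₁ α b n).mulVec
        (fun k => F 0 (sfggrNode α b n k)) i - ((xi - xi) * Y 1 xi + y xi) := by
    have h : (shiftedIntMatrix₂ α b n).mulVec (fun k => Y 2 (sfggrNode α b n k)) i =
        (shiftedIntMatrix₁ α b n).mulVec (fun k => F 0 (sfggrNode α b n k)) i := by
      simp only [Matrix.mulVec, dotProduct, shiftedIntMatrix₂, Matrix.of_apply, F]
      refine Finset.sum_congr rfl fun k _ => ?_
      push_cast
      ring
    rw [yApp, h]
    ring
  rw [← hxi, ← hyApp, ← mul_pow, div_mul_cancel₀ b two_ne_zero] at herr2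
  have hode := hsol.ode xi hxi_mem
  have hres : nodalResidual α b α₁ α₂ n p g (fun k => Y 2 (sfggrNode α b n k)) (y 0) i =
      p xi * (yApp α b α₁ n (fun k => Y 2 (sfggrNode α b n k)) (y 0) i - y xi)
      + α₂ / xi * (α₁ + (shiftedIntMatrix₁ α b n).mulVec
          (fun k => Y 2 (sfggrNode α b n k)) i - Y 1 xi) := by
    rw [← iteratedDerivWithin_one] at hode
    simp only [nodalResidual, yAppDeriv, ← hxi, ← hode, hYdef]
    ring
  have hM0 : 0 ≤ M := (abs_nonneg _).trans (hM b hbb)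
  rw [hres]
  refine (abs_add_le _ _).trans (add_le_add ?_ ?_)
  · rw [abs_mul]
    refine mul_le_mul (hM xi hxi_mem) (herr2.trans ?_) (abs_nonneg _) hM0
    exact mul_le_mul_of_nonneg_right hxi_mem.2 (by positivity)
  · rw [abs_mul, abs_div, abs_of_pos hxi_mem.1]
    refine (mul_le_mul_of_nonneg_left herr1
      (div_nonneg (abs_nonneg α₂) hxi_mem.1.le)).trans_eq ?_
    have := hxi_mem.1.ne'
    field_simp

/-! ### Factorial asymptotics and conclusion. -/

/-- Stirling's lower bound with `√(2π)` dropped, and `(n+1)! ≥ n · n!`, which turns the exponent `-n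
- 1/2` into `-n - 3/2`. -/
theorem inv_factorial_succ_le {n : ℕ} (hn : 1 ≤ n) :
    1 / ((n + 1).factorial : ℝ) ≤ Real.exp 1 ^ n * (n : ℝ) ^ (-(n : ℝ) - 3 / 2) := by
  have hn0 : (0 : ℝ) < n := by exact_mod_cast hn
  have hst := Stirling.le_factorial_stirling n
  have hsqrt : √(n : ℝ) ≤ √(2 * Real.pi * n) := by
    refine Real.sqrt_le_sqrt ?_
    nlinarith [Real.pi_gt_three]
  have hrpow : (n : ℝ) ^ (-(n : ℝ) - 3 / 2) = ((n : ℝ) ^ n * (n * √(n : ℝ)))⁻¹ := by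
    rw [show -(n : ℝ) - 3 / 2 = -((n : ℝ) + (1 + 1 / 2)) by ring, Real.rpow_neg hn0.le,
      Real.rpow_add hn0, Real.rpow_add hn0, Real.rpow_one, Real.rpow_natCast,
      Real.sqrt_eq_rpow]
  have hs : 0 < √(n : ℝ) := Real.sqrt_pos.2 hn0
  rw [hrpow, ← div_eq_mul_inv, div_le_div_iff₀ (by positivity) (by positivity), one_mul]
  have hfac : ((n + 1).factorial : ℝ) = ((n : ℝ) + 1) * n.factorial := by
    push_cast [Nat.factorial_succ]
    ring
  have he : 0 < Real.exp 1 ^ n := pow_pos (Real.exp_pos 1) n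
  have h1 : √(n : ℝ) * (n : ℝ) ^ n ≤ Real.exp 1 ^ n * n.factorial := by
    have h2 := (mul_le_mul_of_nonneg_right hsqrt
      (by positivity : 0 ≤ ((n : ℝ) / Real.exp 1) ^ n)).trans hst
    rw [div_pow, mul_div_assoc', div_le_iff₀ he] at h2
    linarith
  rw [hfac]
  calc (n : ℝ) ^ n * (n * √(n : ℝ)) = n * (√(n : ℝ) * (n : ℝ) ^ n) := by ring
    _ ≤ ((n : ℝ) + 1) * (Real.exp 1 ^ n * n.factorial) := by gcongr; linarith
    _ = _ := by ring

theorem tendsto_mul_pow_div_factorial (b A : ℝ) :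
    Filter.Tendsto (fun n : ℕ => b * ((b * A + ((n : ℝ) + 1) * A) / (n + 1).factorial *
      b ^ (n + 1))) Filter.atTop (nhds 0) := by
  have h := FloorSemiring.tendsto_pow_div_factorial_atTop b
  have h1 := ((Filter.tendsto_add_atTop_iff_nat 1).2 h).const_mul (b ^ 2 * A)
  have h2 := h.const_mul (b ^ 2 * A)
  rw [mul_zero] at h1 h2
  have h3 := h1.add h2
  rw [add_zero] at h3
  refine h3.congr fun n => ?_
  rw [Nat.factorial_succ]
  push_cast
  have : (n.factorial : ℝ) ≠ 0 := by positivity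
  field_simp
  ring

theorem mainTheorem7 (α α₂ A : ℝ) (hα : -1 / 2 < α) :
    ∃ B C : ℝ, 0 < B ∧ 0 < C ∧
      ∀ (b α₁ β γ δ M : ℝ) (p g y : ℝ → ℝ),
        0 < b →
        β = 0 → γ ≠ 0 →
        IsLaneEmdenSolution b α₁ α₂ β γ δ p g y →
        ContDiffOn ℝ (⊤ : ℕ∞) y (Set.Ioc 0 b) →
        (∀ n : ℕ, ∀ x ∈ Set.Ioc 0 b, |iteratedDerivWithin (n + 3) y (Set.Ioc 0 b) x| ≤ A) →
        IsLUB ((fun x => |p x|) '' Set.Ioc 0 b) M →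
        ∀ ε : ℝ, 0 < ε →
          ∃ N : ℕ, 0 < N ∧ ∀ n : ℕ, N ≤ n →
            ∀ (Φ : Fin (n + 1) → ℝ) (y₀ : ℝ),
              ((∀ k, Φ k = iteratedDerivWithin 2 y (Set.Ioc 0 b) (sfggrNode α b n k)) ∧ y₀ = y 0) ∨
                (collocationMatrix α b α₂ n p).mulVec (Sum.elim Φ fun _ => y₀)
                  = collocationRhs α b α₁ α₂ n p g γ δ →
              ∀ i : Fin (n + 1),
                (0 ≤ α →
                  |nodalResidual α b α₁ α₂ n p g Φ y₀ i|
                    ≤ ε * M + B * b ^ (n + 1) * (Real.exp 1 / 4) ^ n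
                        * (n : ℝ) ^ (-(n : ℝ) - 3 / 2 + α)) ∧
                (α < 0 →
                  |nodalResidual α b α₁ α₂ n p g Φ y₀ i|
                    ≤ ε * M + C * (2 : ℝ) ^ (-2 * (n : ℝ) - 1) * b ^ (n + 1) * Real.exp 1 ^ n
                        * (n : ℝ) ^ (-(n : ℝ) - 3 / 2)) := by
  have hc : 0 < 1 + 2 * α := by linarith
  -- The constants of the node polynomial bounds are `4` and `10/(1+2α)`. Since `(b/2)^(n+1) / 2^n =
  -- b^(n+1) 4^(-n) / 2`, the `4` becomes `2`, while in the second case the half is part of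
  -- `2^(-2n-1)`. The added `1` keeps both positive when `α₂ A = 0`.
  refine ⟨2 * |α₂| * |A| + 1, |α₂| * |A| * (2 * (5 / (1 + 2 * α))) + 1, by positivity,
    by positivity, ?_⟩
  intro b α₁ β γ δ M p g y hb _ _ hsol hy hA hM ε hε
  have hbb : b ∈ Set.Ioc 0 b := ⟨hb, le_rfl⟩
  have hpM : ∀ x ∈ Set.Ioc 0 b, |p x| ≤ M := fun x hx => hM.1 ⟨x, hx, rfl⟩
  have hM0 : 0 ≤ M := (abs_nonneg _).trans (hpM b hbb)
  have hA0 : 0 ≤ A := (abs_nonneg _).trans (hA 0 b hbb)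
  -- This threshold makes the error in `y` at most `ε`.
  obtain ⟨N, hN⟩ := Filter.eventually_atTop.1
    ((tendsto_mul_pow_div_factorial b A).eventually_le_const hε)
  refine ⟨N + 1, N.succ_pos, fun n hn Φ y₀ hΦ i => ?_⟩
  have hn1 : 1 ≤ n := by lia
  have hn0 : (0 : ℝ) < n := by exact_mod_cast hn1
  rcases hΦ with ⟨hΦ, rfl⟩ | hcol
  · obtain rfl : Φ = _ := funext hΦ
    have hε' := mul_le_mul_of_nonneg_left (hN n (by lia)) hM0
    rw [mul_comm M ε] at hε'
    have hfac := inv_factorial_succ_le hn1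
    have h4 : ((b / 2) ^ (n + 1) : ℝ) / 2 ^ n = b ^ (n + 1) * (1 / 4) ^ n / 2 := by
      rw [div_pow, div_pow, one_pow, show (4 : ℝ) = 2 * 2 by norm_num, mul_pow, pow_succ 2]
      field_simp
    constructor
    · intro h0
      refine (abs_nodalResidual_le hα hb hsol hy hA hpM hn1
        (fun t ht => abs_prod_sub_fggrNode_le_of_nonneg h0 hn1 ht) i).trans
        (add_le_add hε' ?_)
      calc |α₂| * (A / (n + 1).factorial *
            ((b / 2) ^ (n + 1) * (2 * (2 * (n : ℝ) ^ α) / 2 ^ n)))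
          = |α₂| * A * 4 * (n : ℝ) ^ α * ((b / 2) ^ (n + 1) / 2 ^ n) *
            (1 / (n + 1).factorial) := by ring
        _ = 2 * |α₂| * A * (b ^ (n + 1) * (1 / 4) ^ n * (n : ℝ) ^ α *
            (1 / (n + 1).factorial)) := by rw [h4]; ring
        _ ≤ (2 * |α₂| * |A| + 1) * (b ^ (n + 1) * (1 / 4) ^ n * (n : ℝ) ^ α *
            (Real.exp 1 ^ n * (n : ℝ) ^ (-(n : ℝ) - 3 / 2))) := by
          rw [abs_of_nonneg hA0]
          gcongr
          linarith
        _ = _ := by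
          rw [Real.rpow_add hn0, div_pow, div_pow, one_pow]
          ring
    · intro h0
      refine (abs_nodalResidual_le hα hb hsol hy hA hpM hn1
        (fun t ht => abs_prod_sub_fggrNode_le_of_nonpos hα h0.le n ht) i).trans
        (add_le_add hε' ?_)
      have h2 : (2 : ℝ) ^ (-2 * (n : ℝ) - 1) = (1 / 4) ^ n / 2 := by
        rw [Real.rpow_sub two_pos, Real.rpow_one, Real.rpow_mul two_pos.le, Real.rpow_natCast]
        norm_num [Real.rpow_neg]
      rw [h2]
      set κ := 2 * (5 / (1 + 2 * α)) with hκ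
      have hκ0 : 0 < κ := by positivity
      calc |α₂| * (A / (n + 1).factorial * ((b / 2) ^ (n + 1) * (κ / 2 ^ n)))
          = |α₂| * A * κ * ((b / 2) ^ (n + 1) / 2 ^ n) * (1 / (n + 1).factorial) := by ring
        _ = |α₂| * A * κ * (b ^ (n + 1) * (1 / 4) ^ n / 2 * (1 / (n + 1).factorial)) := by
          rw [h4]; ring
        _ ≤ (|α₂| * |A| * κ + 1) * (b ^ (n + 1) * (1 / 4) ^ n / 2 *
            (Real.exp 1 ^ n * (n : ℝ) ^ (-(n : ℝ) - 3 / 2))) := by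
          rw [abs_of_nonneg hA0]
          gcongr
          linarith
        _ = _ := by ring
  · have hzero : nodalResidual α b α₁ α₂ n p g Φ y₀ i = 0 := by
      rw [nodalResidual_eq_defect α b α₁ α₂ n p g Φ y₀ γ δ i, hcol, sub_self]
    rw [hzero, abs_zero]
    exact ⟨fun _ => by positivity, fun _ => by positivity⟩
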